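/- A series-parallel network is a single resistor, inductor or capacitor (with positive element value and impedance $R$, $Ls$ or $1/(Cs)$ respectively), or a series or parallel connection of two series-parallel networks; impedances add in series, and reciprocals of impedances add in parallel. Let $\mathcal{Z}_M$ denote the set of impedances of series-parallel networks with at most $m$ capacitors and at most $n$ inductors, for some $m,n\ge 0$ with $m+n=M$ (and any finite number of resistors). A rational function $Z\in\mathbb{R}(s)$ is called biquadratic if its McMillan degree is two, i.e. if, in lowest terms, the larger of the degrees of its numerator and denominator is two. For real $p=(p_0,p_1,p_2)$ write $p(s)=p_2s^2+p_1s+p_0$. For two such triples $c,d$ put $$\alpha_1=c_1d_0-c_0d_1,\quad \alpha_2=c_2d_0-c_0d_2,\quad \alpha_3=c_2d_1-c_1d_2,$$ $$\lambda_1=d_1\alpha_1-d_0\alpha_2,\quad \lambda_2=c_1\alpha_3-c_2\alpha_2,\quad \lambda_3=d_2\alpha_2-d_1\alpha_3,\quad \lambda_4=c_0\alpha_2-c_1\alpha_1.$$ For two such triples $p,q$ let $$R_0(p,q)=\det\begin{bmatrix}q_2&q_1&q_0&0\\p_2&p_1&p_0&0\\0&q_2&q_1&q_0\\0&p_2&p_1&p_0\end{bmatrix},$$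 and let $\mathcal{B}(q,p)$ be the $2\times2$ matrix with $\frac{q(v)p(w)-p(v)q(w)}{v-w}=\sum_{i,j=1}^{2}\mathcal{B}_{ij}v^{i-1}w^{j-1}$. Real numbers are said to have the same sign if they are all non-negative or all non-positive. Given real $a=(a_0,a_1,a_2)$, $b=(b_0,b_1,b_2)$, $x\ge0$ and $z\ne0$, consider the following two sets of derived quantities. (I) $\tilde a=a(-x)$, $\tilde b=b(-x)$, $[f_0\ f_1]=[1\ {-x}]\,\mathcal{B}(a,b)$; $c_2=f_1$, $c_1=f_0+xf_1$, $c_0=xf_0$; $h_2=b_2$, $h_1=b_1-zf_1$, $h_0=b_0-zf_0$; $d_i=\tilde b h_i$ $(i=0,1,2)$; $\tilde h=h(-x)$. (II) $\tilde a=a_0x^2-a_1x+a_2$, $\tilde b=b_0x^2-b_1x+b_2$, $[f_0\ f_1]=-[{-x}\ 1]\,\mathcal{B}(a,b)$; $c_2=xf_1$, $c_1=xf_0+f_1$, $c_0=f_0$; $h_2=b_2-zf_1$, $h_1=b_1-zf_0$, $h_0=b_0$; $d_i=\tilde b h_i$ $(i=0,1,2)$; $\tilde h=h_0x^2-h_1x+h_2$.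 In each case $\alpha_1,\alpha_2,\alpha_3,\lambda_1,\dots,\lambda_4$ are formed from these $c,d$. The boundary conditions are: 1. With (I): $a_i,b_i\ge0$ for $i=0,1,2$; $\tilde a,\tilde b,z,d_0,d_1,d_2,f_0,f_1,\lambda_1$ have the same sign; $\alpha_2\ge0$; $\tilde b\tilde hR_0(a,b)\le0$; $\tilde h,R_0(a,b)\ne0$; and $\lambda_1=0$. 2. With (I): $a_i,b_i\ge0$ for $i=0,1,2$; $\tilde a,\tilde b,z,d_0,d_1,d_2,f_0,f_1,\lambda_3$ have the same sign; $\alpha_2\le0$; $\tilde b\tilde hR_0(a,b)\le0$; $\tilde h,R_0(a,b)\ne0$; and $\lambda_3=0$. 3. With (I): $a_i,b_i\ge0$ for $i=0,1,2$; $\tilde a,\tilde b,z,d_0,d_1,d_2,f_0,f_1,\lambda_4$ have the same sign; $\alpha_2\le0$; $\tilde b\tilde hR_0(a,b)\le0$; $\tilde h,R_0(a,b)\ne0$; and $\lambda_4=0$ or $d_0=0$. 4. With (I): $a_i,b_i\ge0$ for $i=0,1,2$; $\tilde a,\tilde b,z,d_0,d_1,d_2,f_0,f_1,\lambda_2$ have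 the same sign; $\alpha_2\ge0$; $\tilde b\tilde hR_0(a,b)\le0$; $\tilde h,R_0(a,b)\ne0$; and $\lambda_2=0$ or $d_2=0$. 5. With (II): $a_i,b_i\ge0$ for $i=0,1,2$; $\tilde a,\tilde b,z,d_0,d_1,d_2,f_0,f_1,\lambda_1$ have the same sign; $\alpha_2\ge0$; $\tilde b\tilde hR_0(a,b)\ge0$; $\tilde h,R_0(a,b)\ne0$; and $d_2=0$. Theorem. Let $Z\in\mathbb{R}(s)$ be biquadratic. Then $Z\in\mathcal{Z}_3$ if and only if either (a) $Z\in\mathcal{Z}_2$; or (b) there exist $x\ge0$, $z\ne0$ and real $a_0,a_1,a_2,b_0,b_1,b_2$ such that $Z$ or $1/Z$ is equal to $$\frac{a_2s^2+a_1s+a_0}{b_2s^2+b_1s+b_0}\qquad\text{or}\qquad\frac{b_0s^2+b_1s+b_2}{a_0s^2+a_1s+a_2},$$ and at least one of the boundary conditions 1--5 holds for $a,b,x,z$. -/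

import Mathlib

open Polynomial Matrix

noncomputable section

/-! ### Series-parallel networks and their impedances -/

/-- Series-parallel networks: a single resistor, inductor or capacitor (with positive element
value), or a series or parallel connection of two series-parallel networks. -/
inductive SPNetwork : Type
  | resistor (R : ℝ) (hR : 0 < R) : SPNetwork
  | inductor (L : ℝ) (hL : 0 < L) : SPNetwork
  | capacitor (C : ℝ) (hC : 0 < C) : SPNetwork
  | series (N₁ N₂ : SPNetwork) : SPNetwork
  | parallel (N₁ N₂ : SPNetwork) : SPNetwork

namespace SPNetwork

/-- The impedance, a real rational function of `s = RatFunc.X`.  As all element values are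
positive, every impedance is positive on the positive half-line, so no inverse below is the
inverse of zero. -/
def impedance : SPNetwork → RatFunc ℝ
  | resistor R _ => RatFunc.C R
  | inductor L _ => RatFunc.C L * RatFunc.X
  | capacitor C _ => (RatFunc.C C * RatFunc.X)⁻¹
  | series N₁ N₂ => N₁.impedance + N₂.impedance
  | parallel N₁ N₂ => (N₁.impedance⁻¹ + N₂.impedance⁻¹)⁻¹

/-- The number of capacitors in a network. -/
def numCapacitors : SPNetwork → ℕ
  | resistor _ _ => 0
  | inductor _ _ => 0
  | capacitor _ _ => 1
  | series N₁ N₂ => N₁.numCapacitors + N₂.numCapacitors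
  | parallel N₁ N₂ => N₁.numCapacitors + N₂.numCapacitors

/-- The number of inductors in a network. -/
def numInductors : SPNetwork → ℕ
  | resistor _ _ => 0
  | inductor _ _ => 1
  | capacitor _ _ => 0
  | series N₁ N₂ => N₁.numInductors + N₂.numInductors
  | parallel N₁ N₂ => N₁.numInductors + N₂.numInductors

end SPNetwork

/-- `𝒵_{m,n}`: impedances of series-parallel networks with at most `m` capacitors and at most
`n` inductors. -/
def impedanceClass₂ (m n : ℕ) : Set (RatFunc ℝ) :=
  {Z | ∃ N : SPNetwork, N.numCapacitors ≤ m ∧ N.numInductors ≤ n ∧ N.impedance = Z}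

/-- `𝒵_M`: the union of the `𝒵_{m,n}` with `m + n = M`. -/
def impedanceClass (M : ℕ) : Set (RatFunc ℝ) :=
  {Z | ∃ m n : ℕ, m + n = M ∧ Z ∈ impedanceClass₂ m n}

/-- The McMillan degree of a rational function: the larger of the degrees of numerator and
denominator in lowest terms. -/
def mcMillanDegree (Z : RatFunc ℝ) : ℕ := max Z.num.natDegree Z.denom.natDegree

/-- A biquadratic is a real rational function of McMillan degree two. -/
def IsBiquadratic (Z : RatFunc ℝ) : Prop := mcMillanDegree Z = 2

/-! ### Pairs of real polynomials of formal degree two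

The triple `p : Fin 3 → ℝ` stands for the polynomial `p 2 * s ^ 2 + p 1 * s + p 0`. -/

/-- The polynomial `p₂ s² + p₁ s + p₀`. -/
def quadPoly (p : Fin 3 → ℝ) : ℝ[X] := C (p 2) * X ^ 2 + C (p 1) * X + C (p 0)

/-- The rational function `(p₂ s² + p₁ s + p₀) / (q₂ s² + q₁ s + q₀)`. -/
def quadRatio (p q : Fin 3 → ℝ) : RatFunc ℝ :=
  algebraMap ℝ[X] (RatFunc ℝ) (quadPoly p) / algebraMap ℝ[X] (RatFunc ℝ) (quadPoly q)

/-- The coefficients of `s² p(1/s)`. -/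
def reverseCoeffs (p : Fin 3 → ℝ) : Fin 3 → ℝ := ![p 2, p 1, p 0]

/-- `R₀(p, q)`: the determinant of the `4 × 4` Sylvester matrix with rows alternating between
`q` and `p`. -/
def sylvesterDet (p q : Fin 3 → ℝ) : ℝ :=
  Matrix.det !![q 2, q 1, q 0, 0;
                p 2, p 1, p 0, 0;
                0, q 2, q 1, q 0;
                0, p 2, p 1, p 0]

/-- The Bezoutian matrix `ℬ(q, p)`; see `bezoutian_eq_iff` for its defining property. -/
def bezoutian (q p : Fin 3 → ℝ) : Matrix (Fin 2) (Fin 2) ℝ :=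
  !![q 1 * p 0 - p 1 * q 0, q 2 * p 0 - p 2 * q 0;
     q 2 * p 0 - p 2 * q 0, q 2 * p 1 - p 2 * q 1]

/-- `ℬ(q, p)` is the matrix of coefficients of `(q(z) p(w) - p(z) q(w)) / (z - w)`. -/
theorem bezoutian_eq_iff (q p : Fin 3 → ℝ) (B : Matrix (Fin 2) (Fin 2) ℝ) :
    B = bezoutian q p ↔
      ∀ z w : ℝ, (quadPoly q).eval z * (quadPoly p).eval w
          - (quadPoly p).eval z * (quadPoly q).eval w
        = (z - w) * ∑ i : Fin 2, ∑ j : Fin 2, B i j * z ^ (i : ℕ) * w ^ (j : ℕ) := by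
  constructor
  · rintro rfl z w
    simp [quadPoly, bezoutian, Fin.sum_univ_two]
    ring
  · intro h
    have h10 := h 1 0
    have h01 := h (-1) 0
    have h02 := h 0 1
    have h03 := h 0 (-1)
    have h21 := h 2 1
    simp [quadPoly, Fin.sum_univ_two] at h10 h01 h02 h03 h21
    ext i j
    fin_cases i <;> fin_cases j <;> simp [bezoutian] <;> linarith

/-- The two determinants agree: `|ℬ(q, p)| = R₀(p, q)`. -/
theorem det_bezoutian (p q : Fin 3 → ℝ) : (bezoutian q p).det = sylvesterDet p q := by
  simp [bezoutian, sylvesterDet, Matrix.det_succ_row_zero, Fin.sum_univ_succ, Fin.succAbove]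
  ring

/-- `α₁` of the pair `c, d`. -/
def alpha₁ (c d : Fin 3 → ℝ) : ℝ := c 1 * d 0 - c 0 * d 1
/-- `α₂` of the pair `c, d`. -/
def alpha₂ (c d : Fin 3 → ℝ) : ℝ := c 2 * d 0 - c 0 * d 2
/-- `α₃` of the pair `c, d`. -/
def alpha₃ (c d : Fin 3 → ℝ) : ℝ := c 2 * d 1 - c 1 * d 2
/-- `λ₁` of the pair `c, d`. -/
def lambda₁ (c d : Fin 3 → ℝ) : ℝ := d 1 * alpha₁ c d - d 0 * alpha₂ c d
/-- `λ₂` of the pair `c, d`. -/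
def lambda₂ (c d : Fin 3 → ℝ) : ℝ := c 1 * alpha₃ c d - c 2 * alpha₂ c d
/-- `λ₃` of the pair `c, d`. -/
def lambda₃ (c d : Fin 3 → ℝ) : ℝ := d 2 * alpha₂ c d - d 1 * alpha₃ c d
/-- `λ₄` of the pair `c, d`. -/
def lambda₄ (c d : Fin 3 → ℝ) : ℝ := c 0 * alpha₂ c d - c 1 * alpha₁ c d

/-- The numbers in `l` have the same sign: all are non-negative or all are non-positive. -/
def SameSign (l : List ℝ) : Prop := (∀ t ∈ l, 0 ≤ t) ∨ (∀ t ∈ l, t ≤ 0)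

/-! ### Extraction of a resistor in series with an inductor

Quantities attached to `a`, `b`, `x`, `z` when the branch `R₅ + L₂ s`, `x = R₅ / L₂`, is removed. -/

namespace RL

/-- `p̃ = p(-x)`. -/
def tilde (p : Fin 3 → ℝ) (x : ℝ) : ℝ := (quadPoly p).eval (-x)

/-- `[f₀ f₁] = [1 -x] ℬ(a, b)`. -/
def f (a b : Fin 3 → ℝ) (x : ℝ) : Fin 2 → ℝ := ![1, -x] ᵥ* bezoutian a b

/-- `c(s) = (s + x) (f₁ s + f₀)`. -/
def c (a b : Fin 3 → ℝ) (x : ℝ) : Fin 3 → ℝ :=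
  ![x * f a b x 0, f a b x 0 + x * f a b x 1, f a b x 1]

/-- `h(s) = b(s) - z (f₁ s + f₀)`. -/
def h (a b : Fin 3 → ℝ) (x z : ℝ) : Fin 3 → ℝ :=
  ![b 0 - z * f a b x 0, b 1 - z * f a b x 1, b 2]

/-- `d = b̃ h`. -/
def d (a b : Fin 3 → ℝ) (x z : ℝ) : Fin 3 → ℝ := tilde b x • h a b x z

/-- The requirements shared by the four conditions below: `aᵢ, bᵢ ≥ 0`; the numbers
`ã, b̃, z, d₀, d₁, d₂, f₀, f₁, lam` have the same sign; `b̃ h̃ R₀(a,b) ≤ 0`;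
and `h̃, R₀(a,b) ≠ 0`. -/
def Common (a b : Fin 3 → ℝ) (x z lam : ℝ) : Prop :=
  (∀ i, 0 ≤ a i) ∧ (∀ i, 0 ≤ b i) ∧
  SameSign [tilde a x, tilde b x, z, d a b x z 0, d a b x z 1, d a b x z 2,
    f a b x 0, f a b x 1, lam] ∧
  tilde b x * tilde (h a b x z) x * sylvesterDet a b ≤ 0 ∧
  tilde (h a b x z) x ≠ 0 ∧ sylvesterDet a b ≠ 0

/-- The sign condition with `λ₁` and `α₂ ≥ 0`. -/
def Cond₁ (a b : Fin 3 → ℝ) (x z : ℝ) : Prop :=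
  Common a b x z (lambda₁ (c a b x) (d a b x z)) ∧ 0 ≤ alpha₂ (c a b x) (d a b x z)

/-- The sign condition with `λ₃` and `α₂ ≤ 0`. -/
def Cond₂ (a b : Fin 3 → ℝ) (x z : ℝ) : Prop :=
  Common a b x z (lambda₃ (c a b x) (d a b x z)) ∧ alpha₂ (c a b x) (d a b x z) ≤ 0

/-- The sign condition with `λ₄` and `α₂ ≤ 0`. -/
def Cond₃ (a b : Fin 3 → ℝ) (x z : ℝ) : Prop :=
  Common a b x z (lambda₄ (c a b x) (d a b x z)) ∧ alpha₂ (c a b x) (d a b x z) ≤ 0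

/-- The sign condition with `λ₂` and `α₂ ≥ 0`. -/
def Cond₄ (a b : Fin 3 → ℝ) (x z : ℝ) : Prop :=
  Common a b x z (lambda₂ (c a b x) (d a b x z)) ∧ 0 ≤ alpha₂ (c a b x) (d a b x z)

end RL

/-! ### Extraction of a resistor in series with a capacitor

Quantities attached to `a`, `b`, `x`, `z` when the branch `R₅ + 1 / (C₁ s)`, `x = R₅ C₁`, is
removed. -/

namespace RC

/-- `p̃ = p₀ x² - p₁ x + p₂`. -/
def tilde (p : Fin 3 → ℝ) (x : ℝ) : ℝ := p 0 * x ^ 2 - p 1 * x + p 2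

/-- `[f₀ f₁] = -[-x 1] ℬ(a, b)`, so that
`(x s + 1) (f₁ s + f₀) = b̃ a(s) - ã b(s)`, as in the inductor case. -/
def f (a b : Fin 3 → ℝ) (x : ℝ) : Fin 2 → ℝ := -(![-x, 1] ᵥ* bezoutian a b)

/-- `c(s) = (x s + 1) (f₁ s + f₀)`. -/
def c (a b : Fin 3 → ℝ) (x : ℝ) : Fin 3 → ℝ :=
  ![f a b x 0, x * f a b x 0 + f a b x 1, x * f a b x 1]

/-- `h(s) = b(s) - z s (f₁ s + f₀)`. -/
def h (a b : Fin 3 → ℝ) (x z : ℝ) : Fin 3 → ℝ :=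
  ![b 0, b 1 - z * f a b x 0, b 2 - z * f a b x 1]

/-- `d = b̃ h`. -/
def d (a b : Fin 3 → ℝ) (x z : ℝ) : Fin 3 → ℝ := tilde b x • h a b x z

/-- `aᵢ, bᵢ ≥ 0`; the numbers `ã, b̃, z, d₀, d₁, d₂, f₀, f₁, λ₁` have the same sign;
`α₂, b̃ h̃ R₀(a,b) ≥ 0`; and `h̃, R₀(a,b) ≠ 0`. -/
def Cond₅ (a b : Fin 3 → ℝ) (x z : ℝ) : Prop :=
  (∀ i, 0 ≤ a i) ∧ (∀ i, 0 ≤ b i) ∧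
  SameSign [tilde a x, tilde b x, z, d a b x z 0, d a b x z 1, d a b x z 2,
    f a b x 0, f a b x 1, lambda₁ (c a b x) (d a b x z)] ∧
  0 ≤ alpha₂ (c a b x) (d a b x z) ∧
  0 ≤ tilde b x * tilde (h a b x z) x * sylvesterDet a b ∧
  tilde (h a b x z) x ≠ 0 ∧ sylvesterDet a b ≠ 0

end RC

/-- In both extractions `c(s) = b̃ a(s) - ã b(s)`. -/
theorem c_eq (a b : Fin 3 → ℝ) (x : ℝ) :
    RL.c a b x = RL.tilde b x • a - RL.tilde a x • b ∧
      RC.c a b x = RC.tilde b x • a - RC.tilde a x • b := by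
  constructor <;> ext i <;> fin_cases i <;>
    simp [RL.c, RL.f, RL.tilde, RC.c, RC.f, RC.tilde, quadPoly, bezoutian, Matrix.vecMul,
      dotProduct, Fin.sum_univ_two] <;> ring

/-- The five boundary conditions on `a`, `b`, `x`, `z`. -/
def BoundaryCondition (a b : Fin 3 → ℝ) (x z : ℝ) : Prop :=
  (RL.Cond₁ a b x z ∧ lambda₁ (RL.c a b x) (RL.d a b x z) = 0) ∨
  (RL.Cond₂ a b x z ∧ lambda₃ (RL.c a b x) (RL.d a b x z) = 0) ∨
  (RL.Cond₃ a b x z ∧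
    (lambda₄ (RL.c a b x) (RL.d a b x z) = 0 ∨ RL.d a b x z 0 = 0)) ∨
  (RL.Cond₄ a b x z ∧
    (lambda₂ (RL.c a b x) (RL.d a b x z) = 0 ∨ RL.d a b x z 2 = 0)) ∨
  (RC.Cond₅ a b x z ∧ RC.d a b x z 2 = 0)

/-- `Z` takes the form `a/b`, or the form `(b₀s² + b₁s + b₂) / (a₀s² + a₁s + a₂)`. -/
def TakesForm (Z : RatFunc ℝ) (a b : Fin 3 → ℝ) : Prop :=
  Z = quadRatio a b ∨ Z = quadRatio (reverseCoeffs b) (reverseCoeffs a)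

end

/-! An impedance is determined by its values on the positive half-line, so the argument is about
functions there (`Realizable`). Duality `1/F` and frequency inversion `F(1/s)` preserve the number
of reactive elements. Together they give four variants of `F`, which become the choice between `Z`
and `1/Z` and between the two quadratic forms.

Two reactances. For a ratio `c/d` with non-negative coefficients and nonzero resultant `R₀`,
realizability with two reactive elements is equivalent to `Regular c d`. After subtracting the
resistance `c₀/d₀`, the remainder is `s(α₂s + α₁)/(d₀d)`, and its real part at `iω` has the sign of
`ω²(α₂d₂ω² + λ₁)`. If `α₂, λ₁ ≥ 0`, the reciprocal of the remainder splits into an inductor term and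
a bilinear term (`realizable_of_lambda₁`). The conditions on `λ₂, λ₃, λ₄` are the images of this one
under the symmetries. The converse is `regular_of_realizable`, and `R₀ > 0` already implies
regularity.

Three reactances, necessity. Unless an element is redundant, up to symmetry `Z = r + (k/(s+x) +
d/c)⁻¹` with `c/d` realizable by two elements (`SPNetwork.realizable_or_extractable`). If `R₀(c,d) =
0`, then `c/d` is bilinear and two elements suffice for `Z`. Otherwise, since `Z` has degree only
two, the forced cancellation occurs at `-x`, so `c = (s+x)f` and `Z = r + c/b` with `b = d + kf`.
Now let only a part `t` of the branch, `0 ≤ t ≤ k`, be removed, leaving `c/(b - tf)`. Its resultant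
is affine in `t`. If it is positive at `0`, then `Z` is regular. If it passes from negative to
positive, at some `t` the factor `s+x` cancels and one element is saved. If it stays negative, the
pair is regular at `t = k`; either it is regular at `0`, and two elements suffice, or the least
regular `t` is positive and some `λᵢ` vanishes there with the right sign of `α₂`
(`exists_boundary`). With `z = t/b(-x)` this is one of the alternatives `λᵢ = 0` of conditions 1–4.

Sufficiency. The derived quantities satisfy `a/b = ã/b̃ + (b̃zw + d/c)⁻¹`, where `w` is `1/(s+x)` or
`s/(xs+1)`. This is a resistance in series with a one-reactance branch parallel to a regular pair.
-/

noncomputable section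

/-! ### Networks on the positive half-line -/

namespace SPNetwork

/-- The number of reactive elements. -/
def numReactive (N : SPNetwork) : ℕ := N.numCapacitors + N.numInductors

/-- The value of the impedance at a real point `s`. -/
def val : SPNetwork → ℝ → ℝ
  | resistor R _, _ => R
  | inductor L _, s => L * s
  | capacitor C _, s => (C * s)⁻¹
  | series N₁ N₂, s => N₁.val s + N₂.val s
  | parallel N₁ N₂, s => ((N₁.val s)⁻¹ + (N₂.val s)⁻¹)⁻¹

theorem val_pos (N : SPNetwork) {s : ℝ} (hs : 0 < s) : 0 < N.val s := by
  induction N with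
  | resistor R hR => exact hR
  | inductor L hL => exact mul_pos hL hs
  | capacitor C hC => exact inv_pos.2 (mul_pos hC hs)
  | series N₁ N₂ h₁ h₂ => exact add_pos h₁ h₂
  | parallel N₁ N₂ h₁ h₂ => exact inv_pos.2 (add_pos (inv_pos.2 h₁) (inv_pos.2 h₂))

/-- The network with reciprocal impedance. -/
def dual : SPNetwork → SPNetwork
  | resistor R hR => resistor R⁻¹ (inv_pos.2 hR)
  | inductor L hL => capacitor L hL
  | capacitor C hC => inductor C hC
  | series N₁ N₂ => parallel N₁.dual N₂.dual
  | parallel N₁ N₂ => series N₁.dual N₂.dual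

/-- The network obtained by the substitution `s ↦ 1 / s`. -/
def freqInv : SPNetwork → SPNetwork
  | resistor R hR => resistor R hR
  | inductor L hL => capacitor L⁻¹ (inv_pos.2 hL)
  | capacitor C hC => inductor C⁻¹ (inv_pos.2 hC)
  | series N₁ N₂ => series N₁.freqInv N₂.freqInv
  | parallel N₁ N₂ => parallel N₁.freqInv N₂.freqInv

/-- The network with all impedances multiplied by `κ`. -/
def scale (κ : ℝ) (hκ : 0 < κ) : SPNetwork → SPNetwork
  | resistor R hR => resistor (κ * R) (mul_pos hκ hR)
  | inductor L hL => inductor (κ * L) (mul_pos hκ hL)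
  | capacitor C hC => capacitor (C / κ) (div_pos hC hκ)
  | series N₁ N₂ => series (N₁.scale κ hκ) (N₂.scale κ hκ)
  | parallel N₁ N₂ => parallel (N₁.scale κ hκ) (N₂.scale κ hκ)

theorem numReactive_series (N₁ N₂ : SPNetwork) :
    (series N₁ N₂).numReactive = N₁.numReactive + N₂.numReactive := by
  simp only [numReactive, numCapacitors, numInductors]; omega

theorem numReactive_parallel (N₁ N₂ : SPNetwork) :
    (parallel N₁ N₂).numReactive = N₁.numReactive + N₂.numReactive := by
  simp only [numReactive, numCapacitors, numInductors]; omega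

theorem numReactive_dual (N : SPNetwork) : N.dual.numReactive = N.numReactive := by
  induction N with
  | series N₁ N₂ h₁ h₂ => rw [dual, numReactive_parallel, numReactive_series, h₁, h₂]
  | parallel N₁ N₂ h₁ h₂ => rw [dual, numReactive_parallel, numReactive_series, h₁, h₂]
  | _ => rfl

theorem numReactive_freqInv (N : SPNetwork) : N.freqInv.numReactive = N.numReactive := by
  induction N with
  | series N₁ N₂ h₁ h₂ => rw [freqInv, numReactive_series, numReactive_series, h₁, h₂]
  | parallel N₁ N₂ h₁ h₂ => rw [freqInv, numReactive_parallel, numReactive_parallel, h₁, h₂]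
  | _ => rfl

theorem numReactive_scale (κ : ℝ) (hκ : 0 < κ) (N : SPNetwork) :
    (N.scale κ hκ).numReactive = N.numReactive := by
  induction N with
  | series N₁ N₂ h₁ h₂ => rw [scale, numReactive_series, numReactive_series, h₁, h₂]
  | parallel N₁ N₂ h₁ h₂ => rw [scale, numReactive_parallel, numReactive_parallel, h₁, h₂]
  | _ => rfl

theorem val_dual (N : SPNetwork) (s : ℝ) : N.dual.val s = (N.val s)⁻¹ := by
  induction N with
  | series N₁ N₂ h₁ h₂ => simp only [dual, val, h₁, h₂, inv_inv]
  | parallel N₁ N₂ h₁ h₂ => simp only [dual, val, h₁, h₂, inv_inv]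
  | resistor R hR => simp only [dual, val]
  | inductor L hL => simp only [dual, val]
  | capacitor C hC => simp only [dual, val, inv_inv]

theorem val_freqInv (N : SPNetwork) (s : ℝ) : N.freqInv.val s = N.val s⁻¹ := by
  induction N with
  | series N₁ N₂ h₁ h₂ => simp only [freqInv, val, h₁, h₂]
  | parallel N₁ N₂ h₁ h₂ => simp only [freqInv, val, h₁, h₂]
  | resistor R hR => simp only [freqInv, val]
  | inductor L hL => simp only [freqInv, val, mul_inv, inv_inv]
  | capacitor C hC => simp only [freqInv, val, mul_inv, inv_inv]

theorem val_scale (κ : ℝ) (hκ : 0 < κ) (N : SPNetwork) (s : ℝ) :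
    (N.scale κ hκ).val s = κ * N.val s := by
  induction N with
  | series N₁ N₂ h₁ h₂ => simp only [scale, val, h₁, h₂, mul_add]
  | parallel N₁ N₂ h₁ h₂ =>
    simp only [scale, val, h₁, h₂, mul_inv, ← mul_add, inv_inv]
  | resistor R hR => simp only [scale, val]
  | inductor L hL => simp only [scale, val, mul_assoc]
  | capacitor C hC => simp only [scale, val, mul_inv, div_eq_mul_inv, inv_inv]; ring

theorem impedance_dual (N : SPNetwork) : N.dual.impedance = N.impedance⁻¹ := by
  induction N with
  | series N₁ N₂ h₁ h₂ => simp only [dual, impedance, h₁, h₂, inv_inv]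
  | parallel N₁ N₂ h₁ h₂ => simp only [dual, impedance, h₁, h₂, inv_inv]
  | resistor R hR => simp only [dual, impedance, map_inv₀]
  | inductor L hL => simp only [dual, impedance]
  | capacitor C hC => simp only [dual, impedance, inv_inv]

/-- Impedances are ratios of polynomials with non-negative coefficients whose degrees are at most
the number of reactive elements. -/
theorem exists_polynomials (N : SPNetwork) : ∃ P Q : ℝ[X],
    (∀ i, 0 ≤ P.coeff i) ∧ (∀ i, 0 ≤ Q.coeff i) ∧
    P.natDegree ≤ N.numReactive ∧ Q.natDegree ≤ N.numReactive ∧ P ≠ 0 ∧ Q ≠ 0 ∧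
    N.impedance = algebraMap ℝ[X] (RatFunc ℝ) P / algebraMap ℝ[X] (RatFunc ℝ) Q ∧
    ∀ s, 0 < s → 0 < P.eval s ∧ 0 < Q.eval s ∧ N.val s = P.eval s / Q.eval s := by
  have coeff_mul_nonneg : ∀ P Q : ℝ[X], (∀ i, 0 ≤ P.coeff i) → (∀ i, 0 ≤ Q.coeff i) →
      ∀ i, 0 ≤ (P * Q).coeff i := by
    intro P Q hP hQ i
    rw [Polynomial.coeff_mul]
    exact Finset.sum_nonneg fun j _ => mul_nonneg (hP _) (hQ _)
  have coeff_add_nonneg : ∀ P Q : ℝ[X], (∀ i, 0 ≤ P.coeff i) → (∀ i, 0 ≤ Q.coeff i) →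
      ∀ i, 0 ≤ (P + Q).coeff i := by
    intro P Q hP hQ i
    rw [Polynomial.coeff_add]
    exact add_nonneg (hP _) (hQ _)
  have inj : ∀ P : ℝ[X], P ≠ 0 → algebraMap ℝ[X] (RatFunc ℝ) P ≠ 0 := fun P hP =>
    RatFunc.algebraMap_ne_zero hP
  have ne_of_pos : ∀ P : ℝ[X], (∀ s : ℝ, 0 < s → 0 < P.eval s) → P ≠ 0 := by
    rintro P h rfl
    simpa using h 1 one_pos
  have hC : ∀ r : ℝ, 0 ≤ r → ∀ i, 0 ≤ (C r : ℝ[X]).coeff i := by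
    intro r hr i
    rw [Polynomial.coeff_C]; split_ifs <;> simp [hr]
  have hCX : ∀ r : ℝ, 0 ≤ r → ∀ i, 0 ≤ (C r * X : ℝ[X]).coeff i := by
    intro r hr i
    rw [Polynomial.coeff_C_mul, Polynomial.coeff_X]; split_ifs <;> simp [hr]
  induction N with
  | resistor R hR =>
    refine ⟨C R, 1, hC R hR.le, ?_, by simp, by simp, by simpa using hR.ne', one_ne_zero, ?_, ?_⟩
    · simpa using hC 1 zero_le_one
    · simp [impedance]
    · intro s hs; simp [val, hR]
  | inductor L hL =>
    refine ⟨C L * X, 1, hCX L hL.le, ?_, ?_, by simp, by simpa using hL.ne', one_ne_zero, ?_, ?_⟩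
    · simpa using hC 1 zero_le_one
    · exact (natDegree_C_mul_le _ _).trans (by simp [numReactive, numCapacitors, numInductors])
    · simp [impedance]
    · intro s hs; simp [val]; positivity
  | capacitor L hL =>
    refine ⟨1, C L * X, ?_, hCX L hL.le, by simp, ?_, one_ne_zero, by simpa using hL.ne', ?_, ?_⟩
    · simpa using hC 1 zero_le_one
    · exact (natDegree_C_mul_le _ _).trans (by simp [numReactive, numCapacitors, numInductors])
    · simp [impedance]
    · intro s hs; simp [val]; positivity
  | series N₁ N₂ h₁ h₂ =>
    obtain ⟨P₁, Q₁, hP₁, hQ₁, dP₁, dQ₁, nP₁, nQ₁, i₁, v₁⟩ := h₁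
    obtain ⟨P₂, Q₂, hP₂, hQ₂, dP₂, dQ₂, nP₂, nQ₂, i₂, v₂⟩ := h₂
    have hv : ∀ s, 0 < s → 0 < (P₁ * Q₂ + P₂ * Q₁).eval s ∧ 0 < (Q₁ * Q₂).eval s ∧
        (series N₁ N₂).val s = (P₁ * Q₂ + P₂ * Q₁).eval s / (Q₁ * Q₂).eval s := by
      intro s hs
      obtain ⟨p₁, q₁, e₁⟩ := v₁ s hs
      obtain ⟨p₂, q₂, e₂⟩ := v₂ s hs
      simp only [eval_add, eval_mul, val]
      refine ⟨by positivity, by positivity, ?_⟩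
      rw [e₁, e₂]; field_simp
    refine ⟨P₁ * Q₂ + P₂ * Q₁, Q₁ * Q₂,
      coeff_add_nonneg _ _ (coeff_mul_nonneg _ _ hP₁ hQ₂) (coeff_mul_nonneg _ _ hP₂ hQ₁),
      coeff_mul_nonneg _ _ hQ₁ hQ₂, ?_, ?_, ne_of_pos _ fun s hs => (hv s hs).1,
      mul_ne_zero nQ₁ nQ₂, ?_, hv⟩
    · rw [numReactive_series]
      refine natDegree_add_le_of_degree_le (natDegree_mul_le.trans ?_) (natDegree_mul_le.trans ?_)
      all_goals omega
    · rw [numReactive_series]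
      exact natDegree_mul_le.trans (by omega)
    · have := inj _ nQ₁
      have := inj _ nQ₂
      simp only [impedance, i₁, i₂, map_add, map_mul]
      field_simp
  | parallel N₁ N₂ h₁ h₂ =>
    obtain ⟨P₁, Q₁, hP₁, hQ₁, dP₁, dQ₁, nP₁, nQ₁, i₁, v₁⟩ := h₁
    obtain ⟨P₂, Q₂, hP₂, hQ₂, dP₂, dQ₂, nP₂, nQ₂, i₂, v₂⟩ := h₂
    have hv : ∀ s, 0 < s → 0 < (P₁ * P₂).eval s ∧ 0 < (Q₁ * P₂ + Q₂ * P₁).eval s ∧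
        (parallel N₁ N₂).val s = (P₁ * P₂).eval s / (Q₁ * P₂ + Q₂ * P₁).eval s := by
      intro s hs
      obtain ⟨p₁, q₁, e₁⟩ := v₁ s hs
      obtain ⟨p₂, q₂, e₂⟩ := v₂ s hs
      simp only [eval_add, eval_mul, val]
      refine ⟨by positivity, by positivity, ?_⟩
      rw [e₁, e₂]; field_simp
    have nS := ne_of_pos _ fun s hs => (hv s hs).2.1
    refine ⟨P₁ * P₂, Q₁ * P₂ + Q₂ * P₁, coeff_mul_nonneg _ _ hP₁ hP₂,
      coeff_add_nonneg _ _ (coeff_mul_nonneg _ _ hQ₁ hP₂) (coeff_mul_nonneg _ _ hQ₂ hP₁),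
      ?_, ?_, mul_ne_zero nP₁ nP₂, nS, ?_, hv⟩
    · rw [numReactive_parallel]
      exact natDegree_mul_le.trans (by omega)
    · rw [numReactive_parallel]
      refine natDegree_add_le_of_degree_le (natDegree_mul_le.trans ?_) (natDegree_mul_le.trans ?_)
      all_goals omega
    · have := inj _ nP₁
      have := inj _ nP₂
      have := inj _ nS
      simp only [impedance, i₁, i₂, inv_div, map_add, map_mul] at this ⊢
      field_simp

end SPNetwork

/-- Polynomials agreeing on the positive half-line are equal. -/
theorem polynomial_eq_of_pos {P Q : ℝ[X]} (h : ∀ s : ℝ, 0 < s → P.eval s = Q.eval s) : P = Q :=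
  Polynomial.eq_of_infinite_eval_eq P Q ((Set.Ioi_infinite (0 : ℝ)).mono fun s hs => h s hs)

/-- An impedance is determined by its values on the positive half-line. -/
theorem SPNetwork.impedance_eq_iff (N : SPNetwork) (P Q : ℝ[X]) (hQ : Q ≠ 0) :
    N.impedance = algebraMap ℝ[X] (RatFunc ℝ) P / algebraMap ℝ[X] (RatFunc ℝ) Q ↔
      ∀ s, 0 < s → N.val s * Q.eval s = P.eval s := by
  obtain ⟨P', Q', -, -, -, -, nP, nQ, hi, hv⟩ := N.exists_polynomials
  rw [hi, div_eq_div_iff (RatFunc.algebraMap_ne_zero nQ) (RatFunc.algebraMap_ne_zero hQ),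
    ← map_mul, ← map_mul, (RatFunc.algebraMap_injective ℝ).eq_iff]
  constructor
  · intro h s hs
    have h' := congrArg (Polynomial.eval s) h
    obtain ⟨-, hq, e⟩ := hv s hs
    rw [e, div_mul_eq_mul_div, div_eq_iff hq.ne']
    simpa using h'
  · intro h
    refine polynomial_eq_of_pos fun s hs => ?_
    obtain ⟨-, hq, e⟩ := hv s hs
    have h' := h s hs
    rw [e, div_mul_eq_mul_div, div_eq_iff hq.ne'] at h'
    simpa using h'

/-- The split of `M` into capacitors and inductors is free, so only the total number of reactive
elements matters. -/
theorem mem_impedanceClass_iff (M : ℕ) (Z : RatFunc ℝ) :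
    Z ∈ impedanceClass M ↔ ∃ N : SPNetwork, N.numReactive ≤ M ∧ N.impedance = Z := by
  constructor
  · rintro ⟨m, n, rfl, N, hm, hn, rfl⟩
    exact ⟨N, add_le_add hm hn, rfl⟩
  · rintro ⟨N, hN, rfl⟩
    refine ⟨N.numCapacitors, M - N.numCapacitors, ?_, N, le_rfl, ?_, rfl⟩
    all_goals simp only [SPNetwork.numReactive] at hN; omega

/-! ### Realizable functions on the positive half-line -/

/-- `F` agrees on the positive half-line with the impedance of a network with at most `M` reactive
elements. -/
def Realizable (M : ℕ) (F : ℝ → ℝ) : Prop :=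
  ∃ N : SPNetwork, N.numReactive ≤ M ∧ ∀ s, 0 < s → N.val s = F s

namespace Realizable

theorem pos {M : ℕ} {F : ℝ → ℝ} (h : Realizable M F) {s : ℝ} (hs : 0 < s) : 0 < F s := by
  obtain ⟨N, -, hN⟩ := h
  exact hN s hs ▸ N.val_pos hs

theorem congr {M : ℕ} {F G : ℝ → ℝ} (h : Realizable M F) (e : ∀ s, 0 < s → F s = G s) :
    Realizable M G := by
  obtain ⟨N, hN, hv⟩ := h
  exact ⟨N, hN, fun s hs => (hv s hs).trans (e s hs)⟩

theorem mono {M M' : ℕ} {F : ℝ → ℝ} (h : Realizable M F) (hM : M ≤ M') : Realizable M' F := by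
  obtain ⟨N, hN, hv⟩ := h
  exact ⟨N, hN.trans hM, hv⟩

theorem inv {M : ℕ} {F : ℝ → ℝ} (h : Realizable M F) : Realizable M fun s => (F s)⁻¹ := by
  obtain ⟨N, hN, hv⟩ := h
  exact ⟨N.dual, N.numReactive_dual ▸ hN, fun s hs => by rw [N.val_dual, hv s hs]⟩

theorem comp_inv {M : ℕ} {F : ℝ → ℝ} (h : Realizable M F) : Realizable M fun s => F s⁻¹ := by
  obtain ⟨N, hN, hv⟩ := h
  exact ⟨N.freqInv, N.numReactive_freqInv ▸ hN, fun s hs => by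
    rw [N.val_freqInv, hv _ (inv_pos.2 hs)]⟩

theorem const_mul {M : ℕ} {F : ℝ → ℝ} (h : Realizable M F) {κ : ℝ} (hκ : 0 < κ) :
    Realizable M fun s => κ * F s := by
  obtain ⟨N, hN, hv⟩ := h
  exact ⟨N.scale κ hκ, N.numReactive_scale κ hκ ▸ hN, fun s hs => by rw [N.val_scale, hv s hs]⟩

theorem add {M M' : ℕ} {F G : ℝ → ℝ} (h : Realizable M F) (h' : Realizable M' G) :
    Realizable (M + M') fun s => F s + G s := by
  obtain ⟨N, hN, hv⟩ := h
  obtain ⟨N', hN', hv'⟩ := h'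
  refine ⟨.series N N', ?_, fun s hs => by rw [SPNetwork.val, hv s hs, hv' s hs]⟩
  rw [SPNetwork.numReactive_series]; omega

theorem par {M M' : ℕ} {F G : ℝ → ℝ} (h : Realizable M F) (h' : Realizable M' G) :
    Realizable (M + M') fun s => ((F s)⁻¹ + (G s)⁻¹)⁻¹ :=
  (h.inv.add h'.inv).inv

theorem const {r : ℝ} (hr : 0 < r) : Realizable 0 fun _ => r :=
  ⟨.resistor r hr, le_rfl, fun _ _ => rfl⟩

theorem const_add {M : ℕ} {F : ℝ → ℝ} (h : Realizable M F) {r : ℝ} (hr : 0 ≤ r) :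
    Realizable M fun s => r + F s := by
  rcases hr.eq_or_lt with rfl | hr
  · exact h.congr fun s _ => (zero_add _).symm
  · exact ((const hr).add h).mono (zero_add M).le

/-- Ratios of polynomials of degree at most one with non-negative coefficients. -/
theorem bilinear {a b c d : ℝ} (ha : 0 ≤ a) (hb : 0 ≤ b) (hc : 0 ≤ c) (hd : 0 ≤ d)
    (hab : 0 < a + b) (hcd : 0 < c + d) : Realizable 1 fun s => (a * s + b) / (c * s + d) := by
  have key : ∀ a b c d : ℝ, 0 ≤ a → 0 ≤ b → 0 ≤ c → 0 ≤ d → 0 < a + b → 0 < c + d →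
      b * c ≤ a * d → Realizable 1 fun s => (a * s + b) / (c * s + d) := by
    intro a b c d ha hb hc hd hab hcd h
    rcases hd.eq_or_lt with rfl | hd
    · have hc : 0 < c := by linarith
      have hb : b = 0 := by
        have : b * c = 0 := le_antisymm (by simpa using h) (by positivity)
        exact (mul_eq_zero.1 this).resolve_right hc.ne'
      subst hb
      have ha : 0 < a := by linarith
      refine ((const (div_pos ha hc)).congr fun s hs => ?_).mono zero_le_one
      field_simp; simp; ring
    · rcases h.eq_or_lt with h | h
      · have hb : 0 < b := by
          rcases hb.eq_or_lt with rfl | hb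
          · have : a * d = 0 := by rw [← h, zero_mul]
            have : a = 0 := (mul_eq_zero.1 this).resolve_right hd.ne'
            linarith
          · exact hb
        refine ((const (div_pos hb hd)).congr fun s hs => ?_).mono zero_le_one
        rw [div_eq_div_iff (by positivity) (by positivity)]
        linear_combination s * h
      -- With `κ = (ad - bc)/d` the function is `b/d + κs/(cs + d)`; the second term is a resistor
      -- `κ/c` in parallel with an inductor `κ/d`, or the inductor alone when `c = 0`.
      · have hκ : 0 < (a * d - b * c) / d := div_pos (by linarith) hd
        have hL : Realizable 1 fun s => (a * d - b * c) / d / d * s :=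
          ⟨.inductor _ (div_pos hκ hd), by simp [SPNetwork.numReactive, SPNetwork.numCapacitors,
            SPNetwork.numInductors], fun s _ => rfl⟩
        have h1 : Realizable 1 fun s => (a * d - b * c) / d * s / (c * s + d) := by
          rcases hc.eq_or_lt with rfl | hc
          · refine hL.congr fun s hs => ?_
            field_simp; ring
          · refine ((const (div_pos hκ hc)).par hL).congr fun s hs => ?_
            have : a * d - b * c ≠ 0 := by linarith
            have := hs.ne'
            field_simp
        refine (h1.const_add (div_nonneg hb hd.le)).congr fun s hs => ?_
        have : c * s + d ≠ 0 := by positivity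
        field_simp; ring
  rcases le_total (b * c) (a * d) with h | h
  · exact key a b c d ha hb hc hd hab hcd h
  -- The substitution `s ↦ 1/s` exchanges `a` with `b` and `c` with `d`, which reverses the
  -- inequality.
  · refine (key b a d c hb ha hd hc (by linarith) (by linarith) h).comp_inv.congr fun s hs => ?_
    have h1 : d * s⁻¹ + c ≠ 0 := by
      rcases hc.eq_or_lt with rfl | hc
      · have : 0 < d := by linarith
        positivity
      · positivity
    have h2 : c * s + d ≠ 0 := by
      have : c * s + d = s * (d * s⁻¹ + c) := by field_simp; ring
      rw [this]; exact mul_ne_zero hs.ne' h1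
    rw [div_eq_div_iff h1 h2]
    field_simp; ring

end Realizable

/-! ### Pairs of triples -/

theorem eval_quadPoly (p : Fin 3 → ℝ) (s : ℝ) :
    (quadPoly p).eval s = p 2 * s ^ 2 + p 1 * s + p 0 := by
  simp [quadPoly]

theorem quadPoly_smul (μ : ℝ) (p : Fin 3 → ℝ) : quadPoly (μ • p) = C μ * quadPoly p := by
  simp [quadPoly]; ring

theorem quadPoly_coeff (p : Fin 3 → ℝ) (i : Fin 3) : (quadPoly p).coeff i = p i := by
  fin_cases i <;> simp [quadPoly, coeff_X, coeff_C]

theorem quadPoly_injective : Function.Injective quadPoly := by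
  intro p q h
  ext i
  rw [← quadPoly_coeff p, h, quadPoly_coeff]

theorem quadPoly_natDegree_le (p : Fin 3 → ℝ) : (quadPoly p).natDegree ≤ 2 :=
  natDegree_quadratic_le

theorem quadPoly_natDegree {p : Fin 3 → ℝ} (h : p 2 ≠ 0) : (quadPoly p).natDegree = 2 :=
  natDegree_quadratic h

theorem quadPoly_of_natDegree_le {P : ℝ[X]} (h : P.natDegree ≤ 2) :
    quadPoly (fun i => P.coeff i) = P := by
  conv_rhs => rw [P.as_sum_range_C_mul_X_pow' (n := 3) (by omega)]
  simp [quadPoly, Finset.sum_range_succ]; ring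

theorem quadPoly_eq_zero {p : Fin 3 → ℝ} : quadPoly p = 0 ↔ p = 0 := by
  constructor
  · intro h
    ext i
    rw [← quadPoly_coeff p i, h]; simp
  · rintro rfl; simp [quadPoly]

theorem eval_quadPoly_pos {p : Fin 3 → ℝ} (hp : ∀ i, 0 ≤ p i) (h : p ≠ 0) {s : ℝ} (hs : 0 < s) :
    0 < (quadPoly p).eval s := by
  rw [eval_quadPoly]
  have h0 := hp 0; have h1 := hp 1; have h2 := hp 2
  by_contra hn
  have e2 : 0 ≤ p 2 * s ^ 2 := by positivity
  have e1 : 0 ≤ p 1 * s := by positivity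
  apply h
  have hs' := hs.ne'
  have z2 : p 2 * s ^ 2 = 0 := by linarith
  have z1 : p 1 * s = 0 := by linarith
  have z0 : p 0 = 0 := by linarith
  simp only [mul_eq_zero, hs', pow_eq_zero_iff, or_false, ne_eq, OfNat.ofNat_ne_zero,
    not_false_eq_true] at z1 z2
  ext i; fin_cases i <;> simp [z0, z1, z2]

theorem sylvesterDet_eq (p q : Fin 3 → ℝ) :
    sylvesterDet p q = alpha₁ p q * alpha₃ p q - alpha₂ p q ^ 2 := by
  rw [← det_bezoutian, Matrix.det_fin_two]
  simp [bezoutian, alpha₁, alpha₂, alpha₃]; ring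

theorem sylvesterDet_swap (p q : Fin 3 → ℝ) : sylvesterDet q p = sylvesterDet p q := by
  simp only [sylvesterDet_eq, alpha₁, alpha₂, alpha₃]; ring

theorem sylvesterDet_reverseCoeffs (p q : Fin 3 → ℝ) :
    sylvesterDet (reverseCoeffs p) (reverseCoeffs q) = sylvesterDet p q := by
  simp only [sylvesterDet_eq, alpha₁, alpha₂, alpha₃, reverseCoeffs]
  simp; ring

theorem sylvesterDet_smul (μ : ℝ) (p q : Fin 3 → ℝ) :
    sylvesterDet (μ • p) (μ • q) = μ ^ 4 * sylvesterDet p q := by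
  simp only [sylvesterDet_eq, alpha₁, alpha₂, alpha₃, Pi.smul_apply, smul_eq_mul]; ring

theorem ne_zero_of_sylvesterDet_ne_zero {p q : Fin 3 → ℝ} (h : sylvesterDet p q ≠ 0) :
    p ≠ 0 ∧ q ≠ 0 := by
  constructor <;> rintro rfl <;> simp [sylvesterDet_eq, alpha₁, alpha₂, alpha₃] at h

/-- Elimination gives `U p + V q = R₀ X` instead of a constant. A combination of `p` and `q` with
nonzero constant term then yields `1`, its higher terms being cancelled by multiples of `R₀ X`. If
neither `p` nor `q` has a constant term, `α₁ = α₂ = 0` and hence `R₀ = 0`. -/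
theorem isCoprime_of_sylvesterDet_ne_zero {p q : Fin 3 → ℝ} (h : sylvesterDet p q ≠ 0) :
    IsCoprime (quadPoly p) (quadPoly q) := by
  set R := sylvesterDet p q with hR
  set U : ℝ[X] := C (alpha₃ p q * q 0) + C (alpha₂ p q * q 2) * X with hU
  set V : ℝ[X] := -C (alpha₃ p q * p 0) - C (alpha₂ p q * p 2) * X with hV
  have hUV : U * quadPoly p + V * quadPoly q = C R * X := by
    refine polynomial_eq_of_pos fun s _ => ?_
    simp only [hU, hV, eval_add, eval_mul, eval_sub, eval_neg, eval_C, eval_X, eval_quadPoly]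
    rw [hR, sylvesterDet_eq]
    simp only [alpha₁, alpha₂, alpha₃]; ring
  have key : ∀ r : Fin 3 → ℝ, r 0 ≠ 0 →
      (∃ A B : ℝ[X], A * quadPoly p + B * quadPoly q = quadPoly r) →
      IsCoprime (quadPoly p) (quadPoly q) := by
    rintro r hr ⟨A, B, hAB⟩
    have e : C (R * r 0)⁻¹ * C R * C (r 0) = (1 : ℝ[X]) := by
      rw [← C_mul, ← C_mul, ← C_1]; congr 1; field_simp
    refine ⟨C (R * r 0)⁻¹ * (C R * A - (C (r 2) * X + C (r 1)) * U),
      C (R * r 0)⁻¹ * (C R * B - (C (r 2) * X + C (r 1)) * V), ?_⟩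
    have hr' : quadPoly r = C (r 2) * X ^ 2 + C (r 1) * X + C (r 0) := rfl
    linear_combination C (R * r 0)⁻¹ * C R * hAB
      - C (R * r 0)⁻¹ * (C (r 2) * X + C (r 1)) * hUV + e + C (R * r 0)⁻¹ * C R * hr'
  by_cases hp : p 0 = 0
  · by_cases hq : q 0 = 0
    · exfalso; apply h
      rw [hR, sylvesterDet_eq]; simp [alpha₁, alpha₂, hp, hq]
    · exact key q hq ⟨0, 1, by ring⟩
  · exact key p hp ⟨1, 0, by ring⟩

/-- Two representations of a function as a ratio of triples are proportional if one of them is in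
lowest terms. -/
theorem exists_smul_of_mul_eq {p q a b : Fin 3 → ℝ} (h : sylvesterDet p q ≠ 0)
    (e : quadPoly p * quadPoly b = quadPoly a * quadPoly q) :
    ∃ μ : ℝ, a = μ • p ∧ b = μ • q := by
  have hc := isCoprime_of_sylvesterDet_ne_zero h
  obtain ⟨hp, hq⟩ := ne_zero_of_sylvesterDet_ne_zero h
  obtain ⟨u, hu⟩ : quadPoly p ∣ quadPoly a := hc.dvd_of_dvd_mul_right ⟨_, e.symm⟩
  have hp' : quadPoly p ≠ 0 := fun h => hp (quadPoly_eq_zero.1 h)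
  have hq' : quadPoly q ≠ 0 := fun h => hq (quadPoly_eq_zero.1 h)
  have hb : quadPoly b = quadPoly q * u := by
    apply mul_left_cancel₀ hp'
    rw [e, hu]; ring
  -- `R₀ ≠ 0` excludes `p₂ = q₂ = 0`, so one of the two has degree exactly two and leaves no room
  -- for a nonconstant cofactor.
  have hdeg : u.natDegree = 0 := by
    by_cases hu0 : u = 0
    · simp [hu0]
    by_cases h2 : p 2 = 0
    · have h2' : q 2 ≠ 0 := by
        intro h2'
        apply h
        rw [sylvesterDet_eq]; simp [alpha₂, alpha₃, h2, h2']
      have := quadPoly_natDegree_le b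
      rw [hb, natDegree_mul hq' hu0, quadPoly_natDegree h2'] at this
      omega
    · have := quadPoly_natDegree_le a
      rw [hu, natDegree_mul hp' hu0, quadPoly_natDegree h2] at this
      omega
  rw [eq_C_of_natDegree_eq_zero hdeg] at hu hb
  refine ⟨u.coeff 0, quadPoly_injective ?_, quadPoly_injective ?_⟩
  · rw [quadPoly_smul, hu]; ring
  · rw [quadPoly_smul, hb]; ring

/-- The ways in which the resultant of formal degree two can vanish. -/
theorem sylvesterDet_eq_zero_cases {p q : Fin 3 → ℝ} (h : sylvesterDet p q = 0) :
    (p 2 = 0 ∧ q 2 = 0) ∨ (p 2 ≠ 0 ∨ q 2 ≠ 0) ∧ p 2 • q = q 2 • p ∨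
      ∃ w, (quadPoly p).eval w = 0 ∧ (quadPoly q).eval w = 0 := by
  by_cases h2 : p 2 = 0 ∧ q 2 = 0
  · exact Or.inl h2
  rw [sylvesterDet_eq] at h
  right
  by_cases h3 : alpha₃ p q = 0
  · left
    have h2' : alpha₂ p q = 0 := by
      rw [h3] at h; simpa using h
    refine ⟨by tauto, ?_⟩
    simp only [alpha₂, alpha₃] at h3 h2'
    ext i; fin_cases i <;> simp <;> linarith
  · right
    -- Eliminating `s²` gives `p₂q - q₂p = α₃s + α₂`, whose root is the only candidate for a common
    -- root.
    refine ⟨-alpha₂ p q / alpha₃ p q, ?_, ?_⟩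
    · rw [eval_quadPoly]; field_simp
      simp only [alpha₁, alpha₂, alpha₃] at h ⊢
      linear_combination (-p 2) * h
    · rw [eval_quadPoly]; field_simp
      simp only [alpha₁, alpha₂, alpha₃] at h ⊢
      linear_combination (-q 2) * h

/-- Division of a triple with non-negative coefficients by `s + x`. -/
theorem exists_factor {c : Fin 3 → ℝ} (hc : ∀ i, 0 ≤ c i) {x : ℝ} (hx : 0 ≤ x)
    (h : (quadPoly c).eval (-x) = 0) :
    ∃ f₀ f₁ : ℝ, 0 ≤ f₀ ∧ 0 ≤ f₁ ∧ c = ![x * f₀, f₀ + x * f₁, f₁] := by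
  rw [eval_quadPoly] at h
  have h0 := hc 0; have h1 := hc 1; have h2 := hc 2
  refine ⟨c 1 - x * c 2, c 2, ?_, h2, ?_⟩
  · rcases hx.eq_or_lt with rfl | hx
    · linarith
    · have : x * (c 1 - x * c 2) = c 0 := by linear_combination -h
      by_contra hn
      nlinarith
  · ext i; fin_cases i
    · simp; linear_combination h
    · simp
    · simp

/-- A ratio of triples which is not in lowest terms reduces to a bilinear one. -/
theorem realizable_one_of_sylvesterDet_eq_zero {c d : Fin 3 → ℝ} (hc : ∀ i, 0 ≤ c i)
    (hd : ∀ i, 0 ≤ d i) (hc0 : c ≠ 0) (hd0 : d ≠ 0) (h : sylvesterDet c d = 0) :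
    Realizable 1 fun s => (quadPoly c).eval s / (quadPoly d).eval s := by
  rcases sylvesterDet_eq_zero_cases h with ⟨h2, h2'⟩ | ⟨h2, e⟩ | ⟨w, hw, hw'⟩
  · have pos : ∀ p : Fin 3 → ℝ, (∀ i, 0 ≤ p i) → p ≠ 0 → p 2 = 0 → 0 < p 1 + p 0 := by
      intro p hp hp0 hp2
      have := eval_quadPoly_pos hp hp0 one_pos
      rw [eval_quadPoly] at this
      linarith
    refine (Realizable.bilinear (hc 1) (hc 0) (hd 1) (hd 0) (pos c hc hc0 h2)
      (pos d hd hd0 h2')).congr fun s _ => ?_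
    simp [eval_quadPoly, h2, h2']
  · have h2c : c 2 ≠ 0 := by
      intro h0
      have h2 : d 2 ≠ 0 := by tauto
      rw [h0, zero_smul] at e
      exact hc0 ((smul_eq_zero.1 e.symm).resolve_left h2)
    have h2d : d 2 ≠ 0 := by
      intro h0
      rw [h0, zero_smul] at e
      exact hd0 ((smul_eq_zero.1 e).resolve_left h2c)
    refine ((Realizable.const (div_pos ((hc 2).lt_of_ne' h2c) ((hd 2).lt_of_ne' h2d))).mono
      zero_le_one).congr fun s hs => ?_
    have := eval_quadPoly_pos hd hd0 hs
    rw [div_eq_div_iff h2d this.ne']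
    have e' := congrArg (fun p => (quadPoly p).eval s) e
    simpa [quadPoly_smul, mul_comm] using e'
  · have hw0 : w ≤ 0 := by
      by_contra hn
      exact (eval_quadPoly_pos hc hc0 (not_le.1 hn)).ne' hw
    obtain ⟨f₀, f₁, hf₀, hf₁, rfl⟩ := exists_factor hc (x := -w) (by linarith) (by simpa using hw)
    obtain ⟨g₀, g₁, hg₀, hg₁, rfl⟩ := exists_factor hd (x := -w) (by linarith) (by simpa using hw')
    have pos : ∀ f₀ f₁ : ℝ, 0 ≤ f₀ → 0 ≤ f₁ → ![-w * f₀, f₀ + -w * f₁, f₁] ≠ 0 → 0 < f₁ + f₀ := by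
      intro f₀ f₁ h₀ h₁ hne
      by_contra hn
      have e₁ : f₁ = 0 := by linarith
      have e₀ : f₀ = 0 := by linarith
      apply hne
      ext i; fin_cases i <;> simp [e₀, e₁]
    have pf := pos _ _ hf₀ hf₁ hc0
    have pg := pos _ _ hg₀ hg₁ hd0
    refine (Realizable.bilinear hf₁ hf₀ hg₁ hg₀ pf pg).congr fun s hs => ?_
    have hsw : s - w ≠ 0 := by linarith
    have e : ∀ f₀ f₁ : ℝ, (quadPoly ![-w * f₀, f₀ + -w * f₁, f₁]).eval s
        = (s - w) * (f₁ * s + f₀) := by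
      intro f₀ f₁; rw [eval_quadPoly]; simp; ring
    rw [e, e, mul_div_mul_left _ _ hsw]

/-! ### Regular pairs -/

/-- Regularity of the ratio of two triples. -/
def Regular (c d : Fin 3 → ℝ) : Prop :=
  (0 ≤ alpha₂ c d ∧ (0 ≤ lambda₁ c d ∨ 0 ≤ lambda₂ c d)) ∨
    (alpha₂ c d ≤ 0 ∧ (0 ≤ lambda₃ c d ∨ 0 ≤ lambda₄ c d))

theorem alpha₂_swap (c d : Fin 3 → ℝ) : alpha₂ d c = -alpha₂ c d := by
  simp only [alpha₂]; ring

theorem lambda₁_swap (c d : Fin 3 → ℝ) : lambda₁ d c = lambda₄ c d := by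
  simp only [lambda₁, lambda₄, alpha₁, alpha₂]; ring

theorem lambda₂_swap (c d : Fin 3 → ℝ) : lambda₂ d c = lambda₃ c d := by
  simp only [lambda₂, lambda₃, alpha₃, alpha₂]; ring

theorem alpha₂_reverseCoeffs (c d : Fin 3 → ℝ) :
    alpha₂ (reverseCoeffs c) (reverseCoeffs d) = -alpha₂ c d := by
  simp [alpha₂, reverseCoeffs]

theorem lambda₁_reverseCoeffs (c d : Fin 3 → ℝ) :
    lambda₁ (reverseCoeffs c) (reverseCoeffs d) = lambda₃ c d := by
  simp [lambda₁, lambda₃, alpha₁, alpha₂, alpha₃, reverseCoeffs]; ring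

theorem lambda₂_reverseCoeffs (c d : Fin 3 → ℝ) :
    lambda₂ (reverseCoeffs c) (reverseCoeffs d) = lambda₄ c d := by
  simp [lambda₂, lambda₄, alpha₁, alpha₂, alpha₃, reverseCoeffs]; ring

theorem reverseCoeffs_reverseCoeffs (c : Fin 3 → ℝ) : reverseCoeffs (reverseCoeffs c) = c := by
  ext i; fin_cases i <;> rfl

theorem reverseCoeffs_nonneg {c : Fin 3 → ℝ} (hc : ∀ i, 0 ≤ c i) (i : Fin 3) :
    0 ≤ reverseCoeffs c i := by
  fin_cases i <;> simp [reverseCoeffs, hc]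

theorem reverseCoeffs_ne_zero {c : Fin 3 → ℝ} (hc : c ≠ 0) : reverseCoeffs c ≠ 0 := by
  intro h
  apply hc
  rw [← reverseCoeffs_reverseCoeffs c, h]
  ext i; fin_cases i <;> rfl

theorem eval_reverseCoeffs (c : Fin 3 → ℝ) {s : ℝ} (hs : s ≠ 0) :
    (quadPoly (reverseCoeffs c)).eval s = s ^ 2 * (quadPoly c).eval s⁻¹ := by
  simp only [eval_quadPoly, reverseCoeffs]
  field_simp; simp; ring

theorem Regular.swap {c d : Fin 3 → ℝ} (h : Regular c d) : Regular d c := by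
  have h3 : lambda₃ d c = lambda₂ c d := (lambda₂_swap d c).symm
  have h4 : lambda₄ d c = lambda₁ c d := (lambda₁_swap d c).symm
  rw [Regular, alpha₂_swap c d, lambda₁_swap c d, lambda₂_swap c d, h3, h4]
  rcases h with ⟨h, h'⟩ | ⟨h, h'⟩
  · exact Or.inr ⟨by linarith, h'.symm⟩
  · exact Or.inl ⟨by linarith, h'.symm⟩

theorem Regular.reverse {c d : Fin 3 → ℝ} (h : Regular c d) :
    Regular (reverseCoeffs c) (reverseCoeffs d) := by
  have h3 := lambda₁_reverseCoeffs (reverseCoeffs c) (reverseCoeffs d)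
  have h4 := lambda₂_reverseCoeffs (reverseCoeffs c) (reverseCoeffs d)
  rw [reverseCoeffs_reverseCoeffs, reverseCoeffs_reverseCoeffs] at h3 h4
  rw [Regular, alpha₂_reverseCoeffs, lambda₁_reverseCoeffs, lambda₂_reverseCoeffs, ← h3, ← h4]
  rcases h with ⟨h, h'⟩ | ⟨h, h'⟩
  · exact Or.inr ⟨by linarith, h'⟩
  · exact Or.inl ⟨by linarith, h'⟩

theorem alpha₂_smul (μ : ℝ) (c d : Fin 3 → ℝ) : alpha₂ (μ • c) (μ • d) = μ ^ 2 * alpha₂ c d := by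
  simp only [alpha₂, Pi.smul_apply, smul_eq_mul]; ring

theorem lambda₁_smul (μ : ℝ) (c d : Fin 3 → ℝ) :
    lambda₁ (μ • c) (μ • d) = μ ^ 3 * lambda₁ c d := by
  simp only [lambda₁, alpha₁, alpha₂, Pi.smul_apply, smul_eq_mul]; ring

theorem lambda₂_smul (μ : ℝ) (c d : Fin 3 → ℝ) :
    lambda₂ (μ • c) (μ • d) = μ ^ 3 * lambda₂ c d := by
  simp only [lambda₂, alpha₃, alpha₂, Pi.smul_apply, smul_eq_mul]; ring

theorem lambda₃_smul (μ : ℝ) (c d : Fin 3 → ℝ) :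
    lambda₃ (μ • c) (μ • d) = μ ^ 3 * lambda₃ c d := by
  simp only [lambda₃, alpha₃, alpha₂, Pi.smul_apply, smul_eq_mul]; ring

theorem lambda₄_smul (μ : ℝ) (c d : Fin 3 → ℝ) :
    lambda₄ (μ • c) (μ • d) = μ ^ 3 * lambda₄ c d := by
  simp only [lambda₄, alpha₁, alpha₂, Pi.smul_apply, smul_eq_mul]; ring

/-- The `λᵢ` are homogeneous of odd degree three, hence the restriction to positive factors. -/
theorem Regular.smul_iff {μ : ℝ} (hμ : 0 < μ) {c d : Fin 3 → ℝ} :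
    Regular (μ • c) (μ • d) ↔ Regular c d := by
  have h2 : 0 < μ ^ 2 := by positivity
  have h3 : 0 < μ ^ 3 := by positivity
  simp only [Regular, alpha₂_smul, lambda₁_smul, lambda₂_smul, lambda₃_smul, lambda₄_smul,
    mul_nonneg_iff_of_pos_left h2, mul_nonneg_iff_of_pos_left h3, mul_nonpos_iff_pos_imp_nonpos]
  simp [h2, h2.le]

/-- The ratio of a pair with `α₂, λ₁ ≥ 0` is realizable with two reactive elements. -/
theorem realizable_of_lambda₁ {c d : Fin 3 → ℝ} (hc : ∀ i, 0 ≤ c i) (hd : ∀ i, 0 ≤ d i)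
    (hc0 : c ≠ 0) (hd0 : d ≠ 0) (hα : 0 ≤ alpha₂ c d) (hl : 0 ≤ lambda₁ c d) :
    Realizable 2 fun s => (quadPoly c).eval s / (quadPoly d).eval s := by
  by_cases hR : sylvesterDet c d = 0
  · exact (realizable_one_of_sylvesterDet_eq_zero hc hd hc0 hd0 hR).mono one_le_two
  have c0 := hc 0; have c1 := hc 1; have c2 := hc 2
  have d0 := hd 0; have d1 := hd 1; have d2 := hd 2
  have hl' : lambda₁ c d = d 1 * alpha₁ c d - d 0 * alpha₂ c d := rfl
  rcases d0.eq_or_lt with h | d0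
  -- If `d₀ = 0`, the two inequalities give `c₀d₂ = c₀d₁² = 0`, so `c₀ = 0` because `d ≠ 0`; then
  -- `s` divides both polynomials and `R₀ = 0`.
  · exfalso
    simp only [lambda₁, alpha₁, alpha₂, ← h, mul_zero, zero_mul, zero_sub, sub_zero] at hα hl
    have e2 : c 0 * d 2 = 0 := le_antisymm (by linarith) (by positivity)
    have e1 : d 1 * (c 0 * d 1) = 0 := le_antisymm (by linarith) (by positivity)
    have e0 : c 0 = 0 := by
      by_contra hne
      have z2 : d 2 = 0 := (mul_eq_zero.1 e2).resolve_left hne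
      have z1 : d 1 = 0 := by
        rcases mul_eq_zero.1 e1 with h | h
        · exact h
        · exact (mul_eq_zero.1 h).resolve_left hne
      apply hd0; ext i; fin_cases i <;> simp [← h, z1, z2]
    apply hR
    rw [sylvesterDet_eq]; simp [alpha₁, alpha₂, ← h, e0]
  · have a1 : 0 < alpha₁ c d := by
      rcases lt_trichotomy (alpha₁ c d) 0 with h | h | h
      · exfalso
        have : d 1 * alpha₁ c d ≤ 0 := mul_nonpos_of_nonneg_of_nonpos d1 h.le
        have : d 1 * alpha₁ c d = 0 := le_antisymm this (by nlinarith [mul_nonneg d0.le hα])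
        have z1 : d 1 = 0 := (mul_eq_zero.1 this).resolve_right h.ne
        have : 0 ≤ alpha₁ c d := by
          simp only [alpha₁, z1, mul_zero, sub_zero]; positivity
        linarith
      · exfalso
        apply hR
        have : d 0 * alpha₂ c d = 0 := by
          refine le_antisymm ?_ (mul_nonneg d0.le hα)
          rw [hl', h] at hl; linarith
        have : alpha₂ c d = 0 := (mul_eq_zero.1 this).resolve_left d0.ne'
        rw [sylvesterDet_eq, h, this]; ring
      · exact h
    set α₁ := alpha₁ c d with hα₁
    set α₂ := alpha₂ c d with hα₂
    set l := lambda₁ c d with hl₁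
    have hL : Realizable 1 fun s => (α₁ * s + 0) / (0 * s + d 0 ^ 2) :=
      Realizable.bilinear a1.le le_rfl le_rfl (by positivity) (by linarith) (by positivity)
    -- This is `d₀d/(s(α₂s + α₁))`, the reciprocal of `c/d - c₀/d₀`, with its pole at `0` removed.
    -- The pole term is the admittance of an inductor; the rest is bilinear because `λ₁ + d₀α₂ =
    -- d₁α₁`.
    have hY : Realizable 2 fun s =>
        (d 0 ^ 2 / (α₁ * s) + d 0 * (d 2 * α₁ * s + l) / (α₁ * (α₂ * s + α₁)))⁻¹ := by
      rcases (show 0 ≤ d 2 * α₁ + l by positivity).eq_or_lt with h | h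
      · have z1 : d 2 * α₁ = 0 := le_antisymm (by linarith) (by positivity)
        have z2 : l = 0 := by linarith
        refine (hL.congr fun s hs => ?_).mono one_le_two
        rw [z1, z2]; simp
      · have hB : Realizable 1 fun s =>
            (α₁ * α₂ * s + α₁ ^ 2) / (d 0 * (d 2 * α₁) * s + d 0 * l) :=
          Realizable.bilinear (by positivity) (by positivity) (by positivity) (by positivity)
            (by positivity) (by rw [← mul_add]; positivity)
        refine (hL.par hB).congr fun s hs => ?_
        simp only [inv_div]
        congr 2
        · simp
        · congr 1 <;> ring
    refine (hY.const_add (div_nonneg c0 d0.le)).congr fun s hs => ?_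
    have hds := eval_quadPoly_pos hd hd0 hs
    have hsα : 0 < α₂ * s + α₁ := by positivity
    have e : d 0 ^ 2 / (α₁ * s) + d 0 * (d 2 * α₁ * s + l) / (α₁ * (α₂ * s + α₁))
        = d 0 * (quadPoly d).eval s / (s * (α₂ * s + α₁)) := by
      rw [eval_quadPoly, hl']
      field_simp; ring
    rw [e, inv_div, div_add_div _ _ d0.ne' (by positivity), div_eq_div_iff (by positivity) hds.ne']
    simp only [eval_quadPoly, hα₁, hα₂, alpha₁, alpha₂]; ring

/-- Regular pairs are realizable with two reactive elements. -/
theorem Regular.realizable {c d : Fin 3 → ℝ} (h : Regular c d) (hc : ∀ i, 0 ≤ c i)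
    (hd : ∀ i, 0 ≤ d i) (hc0 : c ≠ 0) (hd0 : d ≠ 0) :
    Realizable 2 fun s => (quadPoly c).eval s / (quadPoly d).eval s := by
  have key : ∀ {c d : Fin 3 → ℝ}, (∀ i, 0 ≤ c i) → (∀ i, 0 ≤ d i) → c ≠ 0 → d ≠ 0 →
      alpha₂ c d ≤ 0 → 0 ≤ lambda₃ c d →
      Realizable 2 fun s => (quadPoly c).eval s / (quadPoly d).eval s := by
    intro c d hc hd hc0 hd0 hα hl
    refine (realizable_of_lambda₁ (reverseCoeffs_nonneg hc) (reverseCoeffs_nonneg hd)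
      (reverseCoeffs_ne_zero hc0) (reverseCoeffs_ne_zero hd0)
      (by rw [alpha₂_reverseCoeffs]; linarith)
      (by rwa [lambda₁_reverseCoeffs])).comp_inv.congr fun s hs => ?_
    have hs' : (s⁻¹) ^ 2 ≠ 0 := by positivity
    rw [eval_reverseCoeffs _ (inv_ne_zero hs.ne'), eval_reverseCoeffs _ (inv_ne_zero hs.ne'),
      inv_inv, mul_div_mul_left _ _ hs']
  -- `λ₃` is `λ₁` after `s ↦ 1/s`, `λ₄` is `λ₁` of the reciprocal, and `λ₂` combines both
  -- symmetries.
  rcases h with ⟨hα, hl | hl⟩ | ⟨hα, hl | hl⟩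
  · exact realizable_of_lambda₁ hc hd hc0 hd0 hα hl
  · refine (key hd hc hd0 hc0 (by rw [alpha₂_swap]; linarith) ?_).inv.congr fun s _ => inv_div _ _
    rwa [← lambda₂_swap]
  · exact key hc hd hc0 hd0 hα hl
  · refine (realizable_of_lambda₁ hd hc hd0 hc0 (by rw [alpha₂_swap]; linarith) ?_).inv.congr
      fun s _ => inv_div _ _
    rwa [lambda₁_swap]

/-- A pair with positive `R₀` is regular. -/
theorem Regular.of_sylvesterDet_pos {c d : Fin 3 → ℝ} (hc : ∀ i, 0 ≤ c i) (hd : ∀ i, 0 ≤ d i)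
    (h : 0 < sylvesterDet c d) : Regular c d := by
  have key : ∀ {c d : Fin 3 → ℝ}, (∀ i, 0 ≤ c i) → (∀ i, 0 ≤ d i) → 0 < sylvesterDet c d →
      0 < alpha₁ c d → Regular c d := by
    intro c d hc hd h h1
    rw [sylvesterDet_eq] at h
    have d0 := hd 0; have d1 := hd 1; have d2 := hd 2
    have h13 : 0 < alpha₁ c d * alpha₃ c d := by nlinarith [sq_nonneg (alpha₂ c d)]
    have h3 : 0 < alpha₃ c d := pos_of_mul_pos_right h13 h1.le
    -- This expands the vanishing determinant with rows `d`, `c`, `d`.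
    have e : d 1 * alpha₂ c d = d 0 * alpha₃ c d + d 2 * alpha₁ c d := by
      simp only [alpha₁, alpha₂, alpha₃]; ring
    have e0 : 0 ≤ d 0 * alpha₃ c d := by positivity
    have e2 : 0 ≤ d 2 * alpha₁ c d := by positivity
    rcases lt_trichotomy (alpha₂ c d) 0 with h2 | h2 | h2
    · exfalso
      have : d 1 * alpha₂ c d ≤ 0 := mul_nonpos_of_nonneg_of_nonpos d1 h2.le
      have z0 : d 0 = 0 := (mul_eq_zero.1 (by linarith : d 0 * alpha₃ c d = 0)).resolve_right h3.ne'
      have z2 : d 2 = 0 := (mul_eq_zero.1 (by linarith : d 2 * alpha₁ c d = 0)).resolve_right h1.ne'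
      simp [alpha₂, z0, z2] at h2
    · refine Or.inl ⟨h2.ge, Or.inl ?_⟩
      rw [lambda₁, h2]
      simp only [mul_zero, sub_zero]; positivity
    · refine Or.inl ⟨h2.le, Or.inl ?_⟩
      -- Multiplying `λ₁` by `α₂` and using `e` brings in the resultant: `λ₁α₂ = d₀R₀ + d₂α₁²`.
      have : 0 ≤ lambda₁ c d * alpha₂ c d := by
        have : lambda₁ c d * alpha₂ c d = d 0 * (alpha₁ c d * alpha₃ c d - alpha₂ c d ^ 2)
            + d 2 * alpha₁ c d ^ 2 := by
          rw [lambda₁]; linear_combination alpha₁ c d * e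
        rw [this]; positivity
      exact nonneg_of_mul_nonneg_left this h2
  rcases lt_trichotomy (alpha₁ c d) 0 with h1 | h1 | h1
  · refine (key hd hc (by rwa [sylvesterDet_swap]) ?_).swap
    simp only [alpha₁] at h1 ⊢; linarith
  · rw [sylvesterDet_eq, h1] at h
    nlinarith [sq_nonneg (alpha₂ c d)]
  · exact key hc hd h h1

/-! ### Extraction of a branch -/

/-- `F` is the impedance of a resistor in series with a parallel connection of a resistor-inductor
branch and a network with at most `n` reactive elements. -/
def Extractable (n : ℕ) (F : ℝ → ℝ) : Prop :=
  ∃ r k x : ℝ, ∃ G : ℝ → ℝ, 0 ≤ r ∧ 0 < k ∧ 0 ≤ x ∧ Realizable n G ∧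
    ∀ s, 0 < s → F s = r + (k / (s + x) + (G s)⁻¹)⁻¹

/-- One of the four functions obtained from `F` by duality and frequency inversion is
extractable. -/
def ExtractableUpToSymmetry (n : ℕ) (F : ℝ → ℝ) : Prop :=
  Extractable n F ∨ Extractable n (fun s => (F s)⁻¹) ∨ Extractable n (fun s => F s⁻¹) ∨
    Extractable n (fun s => (F s⁻¹)⁻¹)

namespace Extractable

theorem congr {n : ℕ} {F G : ℝ → ℝ} (h : Extractable n F) (e : ∀ s, 0 < s → F s = G s) :
    Extractable n G := by
  obtain ⟨r, k, x, H, hr, hk, hx, hH, hF⟩ := h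
  exact ⟨r, k, x, H, hr, hk, hx, hH, fun s hs => (e s hs).symm.trans (hF s hs)⟩

theorem const_add {n : ℕ} {F : ℝ → ℝ} (h : Extractable n F) {R : ℝ} (hR : 0 ≤ R) :
    Extractable n fun s => R + F s := by
  obtain ⟨r, k, x, H, hr, hk, hx, hH, hF⟩ := h
  exact ⟨R + r, k, x, H, by positivity, hk, hx, hH, fun s hs => by simp only [hF s hs, add_assoc]⟩

/-- A shunt conductance can be pushed past the series resistor: with `p = 1 + gr`, shunting `r +
1/Y` by `g` gives `r/p + (gp + p²Y)⁻¹`. The branch is scaled, its pole `-x` is kept, and the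
conductance `gp` is absorbed in the remaining network. -/
theorem const_par {n : ℕ} {F : ℝ → ℝ} (h : Extractable n F) {g : ℝ} (hg : 0 ≤ g) :
    Extractable n fun s => (g + (F s)⁻¹)⁻¹ := by
  obtain ⟨r, k, x, H, hr, hk, hx, hH, hF⟩ := h
  have hp : 0 < 1 + g * r := by positivity
  have hH' : Realizable n fun s =>
      (g * (1 + g * r) + ((((1 + g * r) ^ 2)⁻¹ * H s))⁻¹)⁻¹ :=
    ((hH.const_mul (κ := ((1 + g * r) ^ 2)⁻¹) (by positivity)).inv.const_add
      (r := g * (1 + g * r)) (by positivity)).inv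
  refine ⟨r / (1 + g * r), (1 + g * r) ^ 2 * k, x, _, by positivity, by positivity, hx, hH',
    fun s hs => ?_⟩
  have hHs := hH.pos hs
  have hY : 0 < k / (s + x) + (H s)⁻¹ := by positivity
  simp only [hF s hs]
  rw [inv_inv, mul_inv, inv_inv, mul_div_assoc, show ∀ u v w t : ℝ,
    u * v + (w + u * t) = w + u * (v + t) by intros; ring]
  set Y := k / (s + x) + (H s)⁻¹
  have h1 : r + Y⁻¹ ≠ 0 := by positivity
  have h2 : g + (r + Y⁻¹)⁻¹ ≠ 0 := by positivity
  have h3 : g * (1 + g * r) + (1 + g * r) ^ 2 * Y ≠ 0 := by positivity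
  have h4 : r * Y + 1 ≠ 0 := by positivity
  have h5 : g * (r * Y + 1) + Y ≠ 0 := by positivity
  have e1 : (g + (r + Y⁻¹)⁻¹)⁻¹ = (r * Y + 1) / (g * (r * Y + 1) + Y) := by
    have : r + Y⁻¹ = (r * Y + 1) / Y := by field_simp
    rw [this, inv_div, eq_div_iff h5, inv_mul_eq_div, div_eq_iff (by positivity)]
    field_simp
  have e2 : g * (1 + g * r) + (1 + g * r) ^ 2 * Y = (1 + g * r) * (g * (r * Y + 1) + Y) := by ring
  rw [e1, e2]
  field_simp
  ring

end Extractable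

namespace ExtractableUpToSymmetry

theorem congr {n : ℕ} {F G : ℝ → ℝ} (h : ExtractableUpToSymmetry n F)
    (e : ∀ s, 0 < s → F s = G s) : ExtractableUpToSymmetry n G := by
  rcases h with h | h | h | h
  · exact Or.inl (h.congr e)
  · exact Or.inr (Or.inl (h.congr fun s hs => by rw [e s hs]))
  · exact Or.inr (Or.inr (Or.inl (h.congr fun s hs => by rw [e _ (inv_pos.2 hs)])))
  · exact Or.inr (Or.inr (Or.inr (h.congr fun s hs => by rw [e _ (inv_pos.2 hs)])))

theorem inv {n : ℕ} {F : ℝ → ℝ} (h : ExtractableUpToSymmetry n F) :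
    ExtractableUpToSymmetry n fun s => (F s)⁻¹ := by
  simp only [ExtractableUpToSymmetry, inv_inv] at h ⊢
  tauto

theorem const_add {n : ℕ} {F : ℝ → ℝ} (h : ExtractableUpToSymmetry n F) {r : ℝ} (hr : 0 ≤ r) :
    ExtractableUpToSymmetry n fun s => r + F s := by
  rcases h with h | h | h | h
  · exact Or.inl (h.const_add hr)
  · exact Or.inr (Or.inl ((h.const_par hr).congr fun s _ => by rw [inv_inv]))
  · exact Or.inr (Or.inr (Or.inl (h.const_add hr)))
  · exact Or.inr (Or.inr (Or.inr ((h.const_par hr).congr fun s _ => by rw [inv_inv])))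

end ExtractableUpToSymmetry

/-! ### Decomposition of networks with few reactive elements -/

theorem SPNetwork.exists_const {N : SPNetwork} (h : N.numReactive = 0) :
    ∃ r, 0 < r ∧ ∀ s, N.val s = r := by
  induction N with
  | resistor R hR => exact ⟨R, hR, fun _ => rfl⟩
  | inductor L hL => simp [numReactive, numInductors] at h
  | capacitor C hC => simp [numReactive, numCapacitors] at h
  | series N₁ N₂ h₁ h₂ =>
    rw [numReactive_series] at h
    obtain ⟨r₁, p₁, e₁⟩ := h₁ (by omega)
    obtain ⟨r₂, p₂, e₂⟩ := h₂ (by omega)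
    exact ⟨r₁ + r₂, by positivity, fun s => by rw [val, e₁, e₂]⟩
  | parallel N₁ N₂ h₁ h₂ =>
    rw [numReactive_parallel] at h
    obtain ⟨r₁, p₁, e₁⟩ := h₁ (by omega)
    obtain ⟨r₂, p₂, e₂⟩ := h₂ (by omega)
    exact ⟨(r₁⁻¹ + r₂⁻¹)⁻¹, by positivity, fun s => by rw [val, e₁, e₂]⟩

/-- Impedances of networks with at most one reactive element are bilinear. -/
theorem Realizable.exists_bilinear {F : ℝ → ℝ} (h : Realizable 1 F) :
    ∃ a b c d : ℝ, 0 ≤ a ∧ 0 ≤ b ∧ 0 ≤ c ∧ 0 ≤ d ∧ 0 < a + b ∧ 0 < c + d ∧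
      ∀ s, 0 < s → F s = (a * s + b) / (c * s + d) := by
  obtain ⟨N, hN, hv⟩ := h
  obtain ⟨P, Q, hP, hQ, dP, dQ, -, -, -, e⟩ := N.exists_polynomials
  have ev : ∀ P : ℝ[X], P.natDegree ≤ N.numReactive → ∀ s,
      P.eval s = P.coeff 1 * s + P.coeff 0 := by
    intro P hP s
    conv_lhs => rw [P.as_sum_range_C_mul_X_pow' (n := 2) (by omega)]
    simp [Finset.sum_range_succ]; ring
  obtain ⟨pP, pQ, -⟩ := e 1 one_pos
  rw [ev P dP, mul_one] at pP
  rw [ev Q dQ, mul_one] at pQ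
  refine ⟨_, _, _, _, hP 1, hP 0, hQ 1, hQ 0, pP, pQ, fun s hs => ?_⟩
  rw [← hv s hs, (e s hs).2.2, ev P dP, ev Q dQ]

/-- A parallel connection in which one part has a single reactive element. -/
theorem realizable_or_extractable_par {n : ℕ} {F G : ℝ → ℝ} (hF : Realizable 1 F)
    (hG : Realizable n G) : Realizable n (fun s => ((F s)⁻¹ + (G s)⁻¹)⁻¹) ∨
      ExtractableUpToSymmetry n fun s => ((F s)⁻¹ + (G s)⁻¹)⁻¹ := by
  have key : ∀ {G : ℝ → ℝ} {a b c d : ℝ}, Realizable n G → 0 ≤ a → 0 ≤ b → 0 ≤ c → 0 ≤ d →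
      0 < a + b → 0 < c + d → b * c < a * d →
      Extractable n fun s => ((c * s + d) / (a * s + b) + (G s)⁻¹)⁻¹ := by
    intro G a b c d hG ha hb hc hd hab hcd h
    have ha : 0 < a := by
      rcases ha.eq_or_lt with rfl | ha
      · nlinarith [mul_nonneg hb hc]
      · exact ha
    -- The admittance `(cs + d)/(as + b)` is `c/a` plus a pole at `-b/a` with residue `(ad -
    -- bc)/a²`; the constant `c/a` is moved to `G`.
    refine ⟨0, (a * d - b * c) / a ^ 2, b / a, fun s => (c / a + (G s)⁻¹)⁻¹, le_rfl,
      div_pos (by linarith) (by positivity), by positivity,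
      (hG.inv.const_add (by positivity)).inv, fun s hs => ?_⟩
    rw [zero_add, inv_inv, ← add_assoc]
    beta_reduce
    congr 2
    have : a * s + b ≠ 0 := by positivity
    field_simp
    ring
  obtain ⟨a, b, c, d, ha, hb, hc, hd, hab, hcd, hv⟩ := hF.exists_bilinear
  rcases lt_trichotomy (b * c) (a * d) with h | h | h
  · right; left
    refine (key hG ha hb hc hd hab hcd h).congr fun s hs => ?_
    rw [hv s hs, inv_div]
  · left
    refine (hG.inv.const_add (r := (c + d) / (a + b)) (by positivity)).inv.congr fun s hs => ?_
    rw [hv s hs, inv_div]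
    congr 2
    have h2 : a * s + b ≠ 0 := by
      rcases ha.eq_or_lt with rfl | ha
      · have : 0 < b := by linarith
        positivity
      · positivity
    rw [div_eq_div_iff hab.ne' h2]
    linear_combination (1 - s) * h
  -- Here the one-reactance part is capacitive; after `s ↦ 1/s` it is inductive.
  · right; right; right; left
    refine (key hG.comp_inv hb ha hd hc (by linarith) (by linarith) h).congr fun s hs => ?_
    simp only [hv _ (inv_pos.2 hs), inv_div]
    congr 2
    have h2 : a * s⁻¹ + b ≠ 0 := by
      rcases ha.eq_or_lt with rfl | ha
      · have : 0 < b := by linarith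
        positivity
      · positivity
    have h3 : b * s + a ≠ 0 := by
      have : b * s + a = s * (a * s⁻¹ + b) := by field_simp; ring
      rw [this]; exact mul_ne_zero hs.ne' h2
    rw [div_eq_div_iff h3 h2]
    field_simp; ring

/-- Networks with two or three reactive elements have a branch that can be extracted, unless one
reactive element is redundant. -/
theorem SPNetwork.realizable_or_extractable {n : ℕ} (h1 : 1 ≤ n) (h2 : n ≤ 2) (N : SPNetwork)
    (hN : N.numReactive ≤ n + 1) : Realizable n N.val ∨ ExtractableUpToSymmetry n N.val := by
  have step : ∀ N₁ N₂ : SPNetwork, N₁.numReactive + N₂.numReactive ≤ n + 1 →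
      (Realizable n N₁.val ∨ ExtractableUpToSymmetry n N₁.val) →
      (Realizable n N₂.val ∨ ExtractableUpToSymmetry n N₂.val) →
      (Realizable n (fun s => N₁.val s + N₂.val s) ∨
        ExtractableUpToSymmetry n fun s => N₁.val s + N₂.val s) := by
    intro N₁ N₂ hN i₁ i₂
    have main : ∀ N₁ N₂ : SPNetwork, N₁.numReactive ≤ 1 → N₂.numReactive ≤ n →
        (Realizable n (fun s => N₁.val s + N₂.val s) ∨
          ExtractableUpToSymmetry n fun s => N₁.val s + N₂.val s) := by
      intro N₁ N₂ b₁ b₂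
      have r₁ : Realizable 1 N₁.val := ⟨N₁, b₁, fun _ _ => rfl⟩
      have r₂ : Realizable n N₂.val := ⟨N₂, b₂, fun _ _ => rfl⟩
      rcases realizable_or_extractable_par r₁.inv r₂.inv with h | h
      · exact Or.inl (h.inv.congr fun s _ => by simp)
      · exact Or.inr (h.inv.congr fun s _ => by simp)
    rcases Nat.eq_zero_or_pos N₁.numReactive with z₁ | p₁
    · obtain ⟨r, hr, e⟩ := exists_const z₁
      rcases i₂ with h | h
      · exact Or.inl ((h.const_add hr.le).congr fun s _ => by rw [e])
      · exact Or.inr ((h.const_add hr.le).congr fun s _ => by rw [e])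
    rcases Nat.eq_zero_or_pos N₂.numReactive with z₂ | p₂
    · obtain ⟨r, hr, e⟩ := exists_const z₂
      rcases i₁ with h | h
      · exact Or.inl ((h.const_add hr.le).congr fun s _ => by rw [e, add_comm])
      · exact Or.inr ((h.const_add hr.le).congr fun s _ => by rw [e, add_comm])
    -- Both parts are reactive and the total is at most `n + 1 ≤ 3`, so one part has a single
    -- reactive element and the other at most `n`.
    by_cases b₁ : N₁.numReactive ≤ 1
    · exact main N₁ N₂ b₁ (by omega)
    · rcases main N₂ N₁ (by omega) (by omega) with h | h
      · exact Or.inl (h.congr fun s _ => add_comm _ _)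
      · exact Or.inr (h.congr fun s _ => add_comm _ _)
  induction N with
  | resistor R hR => exact Or.inl ⟨.resistor R hR, Nat.zero_le _, fun _ _ => rfl⟩
  | inductor L hL => exact Or.inl ⟨.inductor L hL, h1, fun _ _ => rfl⟩
  | capacitor C hC => exact Or.inl ⟨.capacitor C hC, h1, fun _ _ => rfl⟩
  | series N₁ N₂ i₁ i₂ =>
    rw [numReactive_series] at hN
    exact step N₁ N₂ hN (i₁ (by omega)) (i₂ (by omega))
  | parallel N₁ N₂ i₁ i₂ =>
    rw [numReactive_parallel] at hN
    have dualize : ∀ N : SPNetwork, (Realizable n N.val ∨ ExtractableUpToSymmetry n N.val) →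
        (Realizable n N.dual.val ∨ ExtractableUpToSymmetry n N.dual.val) := by
      intro N h
      rcases h with h | h
      · exact Or.inl (h.inv.congr fun s _ => (N.val_dual s).symm)
      · exact Or.inr (h.inv.congr fun s _ => (N.val_dual s).symm)
    rcases step N₁.dual N₂.dual (by rwa [numReactive_dual, numReactive_dual])
      (dualize _ (i₁ (by omega))) (dualize _ (i₂ (by omega))) with h | h
    · exact Or.inl (h.inv.congr fun s _ => by simp only [val_dual, val])
    · exact Or.inr (h.inv.congr fun s _ => by simp only [val_dual, val])

/-! ### Networks with two reactive elements are regular -/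

/-- The pair represents `r + (k/(s+x) + (g₁s+g₀)/(f₁s+f₀))⁻¹`. The sign of `D = f₀g₁ - f₁g₀` tells
whether the bilinear part is inductive (`D ≤ 0`, where `α₂, λ₂ ≥ 0`) or capacitive. The resistance
`r` does not affect `α₂, λ₁, λ₃`, but subtracts `rλ₃` from `λ₂` and `rλ₁` from `λ₄`. For `D, f₁ > 0`
the proof therefore compares signs at `r = 0`. When `α₂ ≥ 0`, either `λ₂` is non-negative at `r = 0`
and `λ₃ ≤ 0`, so `λ₂ ≥ 0` for every `r`, or `λ₁ ≥ 0`. When `α₂ ≤ 0`, the same dichotomy holds with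
`λ₄` and `λ₁` in place of `λ₂` and `λ₃`, and `λ₃` in place of the last `λ₁`. -/
theorem regular_of_bilinear_branch {r k x f₀ f₁ g₀ g₁ : ℝ} (hr : 0 ≤ r) (hk : 0 < k) (hx : 0 ≤ x)
    (hf₀ : 0 ≤ f₀) (hf₁ : 0 ≤ f₁) (hg₀ : 0 ≤ g₀) (hg₁ : 0 ≤ g₁) {c d : Fin 3 → ℝ}
    (hd : d = ![k * f₀ + x * g₀, k * f₁ + g₀ + x * g₁, g₁])
    (hc : c = ![x * f₀, f₀ + x * f₁, f₁] + r • d) : Regular c d := by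
  obtain ⟨D, hD⟩ : ∃ D, f₀ * g₁ = D + f₁ * g₀ := ⟨f₀ * g₁ - f₁ * g₀, by ring⟩
  have hα : alpha₂ c d = k * f₀ * f₁ - x * D := by
    simp [alpha₂, hc, hd]; linear_combination -x * hD
  have h₁ : lambda₁ c d = k * g₀ * f₀ ^ 2 + 2 * k * x * f₀ * D - k * f₁ * x ^ 2 * D
      - x ^ 3 * g₁ * D := by
    simp [lambda₁, alpha₁, alpha₂, hc, hd]
    rw [show D = f₀ * g₁ - f₁ * g₀ by linarith]; ring
  have h₃ : lambda₃ c d = D * (2 * k * f₁ + g₀) - k ^ 2 * f₁ ^ 3 - x * k * g₁ * f₁ ^ 2 := by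
    simp [lambda₃, alpha₂, alpha₃, hc, hd]
    rw [show D = f₀ * g₁ - f₁ * g₀ by linarith]; ring
  have h₂ : lambda₂ c d = k * x * f₁ ^ 3 - f₀ * D - r * lambda₃ c d := by
    simp [lambda₂, lambda₃, alpha₂, alpha₃, hc, hd]
    rw [show D = f₀ * g₁ - f₁ * g₀ by linarith]; ring
  have h₄ : lambda₄ c d = x ^ 3 * f₁ * D - k * f₀ ^ 3 - r * lambda₁ c d := by
    simp [lambda₁, lambda₄, alpha₁, alpha₂, hc, hd]
    rw [show D = f₀ * g₁ - f₁ * g₀ by linarith]; ring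
  rcases le_or_gt D 0 with hD0 | hD0
  · have hDn : 0 ≤ -D := by linarith
    refine Or.inl ⟨?_, Or.inr ?_⟩
    · have : 0 ≤ k * f₀ * f₁ + x * -D := by positivity
      rw [hα]; linarith
    · have e3 : lambda₃ c d ≤ 0 := by
        have : 0 ≤ -D * (2 * k * f₁ + g₀) + k ^ 2 * f₁ ^ 3 + x * k * g₁ * f₁ ^ 2 := by positivity
        rw [h₃]; linarith
      have e2 : 0 ≤ k * x * f₁ ^ 3 + f₀ * -D := by positivity
      have := mul_nonneg hr (neg_nonneg.2 e3)
      rw [h₂]; linarith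
  have hl₁ : lambda₁ c d * f₁
      = g₁ * (k * f₀ ^ 3 - x ^ 3 * f₁ * D) - k * D * (f₀ - x * f₁) ^ 2 := by
    rw [h₁]; linear_combination (-k * f₀ ^ 2) * hD
  have hf₀ : 0 < f₀ := by
    rcases hf₀.eq_or_lt with rfl | hf₀
    · nlinarith [mul_nonneg hf₁ hg₀]
    · exact hf₀
  rcases hf₁.eq_or_lt with rfl | hf₁
  · refine Or.inr ⟨?_, Or.inl ?_⟩
    · rw [hα]; nlinarith [mul_nonneg hx hD0.le]
    · rw [h₃]
      have : 0 ≤ D * g₀ := by positivity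
      linarith
  rcases le_total 0 (alpha₂ c d) with hα0 | hα0
  · refine Or.inl ⟨hα0, ?_⟩
    rw [hα] at hα0
    rcases le_total (f₀ * D) (k * x * f₁ ^ 3) with hB | hB
    · right
      have e3 : f₀ * lambda₃ c d ≤ 0 := by
        have e : f₀ * lambda₃ c d = -(g₀ * (k * x * f₁ ^ 3 - f₀ * D))
            - (f₀ * (k * f₁ ^ 2 - D) ^ 2 + D * (k * x * f₁ ^ 3 - f₀ * D)) / f₁ := by
          rw [h₃, eq_sub_iff_add_eq, ← eq_sub_iff_add_eq', div_eq_iff hf₁.ne']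
          linear_combination (-x * k * f₁ ^ 3) * hD
        rw [e]
        have i1 : 0 ≤ k * x * f₁ ^ 3 - f₀ * D := by linarith
        have i2 : 0 ≤ g₀ * (k * x * f₁ ^ 3 - f₀ * D) := by positivity
        have i3 : 0 ≤ (f₀ * (k * f₁ ^ 2 - D) ^ 2 + D * (k * x * f₁ ^ 3 - f₀ * D)) / f₁ := by
          positivity
        linarith
      have e3' : 0 ≤ -lambda₃ c d := by
        by_contra hn
        have := mul_pos hf₀ (by linarith : 0 < lambda₃ c d)
        linarith
      have := mul_nonneg hr e3'
      rw [h₂]; linarith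
    · left
      have i1 : (x * f₁) ^ 2 ≤ f₀ ^ 2 := by
        have : x * (k * x * f₁ ^ 3) ≤ f₀ * (k * f₀ * f₁) :=
          (mul_le_mul_of_nonneg_left hB hx).trans (by nlinarith)
        have : (k * f₁) * (x * f₁) ^ 2 ≤ (k * f₁) * f₀ ^ 2 := by linarith
        exact le_of_mul_le_mul_left this (by positivity)
      have i2 : x * f₁ ≤ f₀ := by nlinarith
      have i3 : x ^ 3 * f₁ * D ≤ k * f₀ * (x * f₁) ^ 2 := by
        have := mul_le_mul_of_nonneg_left hα0 (by positivity : 0 ≤ x ^ 2 * f₁)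
        linarith
      have i4 : 0 ≤ k * f₀ ^ 3 - x ^ 3 * f₁ * D := by
        have := mul_le_mul_of_nonneg_left i1 (by positivity : 0 ≤ k * f₀)
        linarith
      have i5 : D * (k * f₀ ^ 3 - x ^ 3 * f₁ * D) ≤ f₀ * g₁ * (k * f₀ ^ 3 - x ^ 3 * f₁ * D) := by
        refine mul_le_mul_of_nonneg_right ?_ i4
        rw [hD]
        have : 0 ≤ f₁ * g₀ := by positivity
        linarith
      have i6 := mul_le_mul_of_nonneg_left i3 hD0.le
      have i7 : 0 ≤ 2 * D * k * x * f₀ * f₁ * (f₀ - x * f₁) :=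
        mul_nonneg (by positivity) (by linarith)
      have i8 : 0 ≤ (f₀ * f₁) * lambda₁ c d := by
        have : (f₀ * f₁) * lambda₁ c d = f₀ * (lambda₁ c d * f₁) := by ring
        rw [this, hl₁]
        nlinarith
      exact nonneg_of_mul_nonneg_right i8 (by positivity)
  · refine Or.inr ⟨hα0, ?_⟩
    rw [hα] at hα0
    rcases le_total (k * f₀ ^ 3) (x ^ 3 * f₁ * D) with hA | hA
    · right
      have : lambda₁ c d * f₁ ≤ 0 := by
        rw [hl₁]
        have := mul_nonneg hg₁ (by linarith : 0 ≤ x ^ 3 * f₁ * D - k * f₀ ^ 3)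
        have : 0 ≤ k * D * (f₀ - x * f₁) ^ 2 := by positivity
        linarith
      have i1 : 0 ≤ -lambda₁ c d := by
        by_contra hn
        have := mul_pos (by linarith : 0 < lambda₁ c d) hf₁
        linarith
      have := mul_nonneg hr i1
      rw [h₄]; linarith
    · left
      have i1 : x * f₁ ≤ f₀ := by
        have := mul_le_mul_of_nonneg_left hα0 (by positivity : 0 ≤ x ^ 2 * f₁)
        have i1 : (k * f₀) * (x * f₁) ^ 2 ≤ (k * f₀) * f₀ ^ 2 := by linarith
        have := le_of_mul_le_mul_left i1 (by positivity)
        nlinarith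
      have i2 : k * f₁ ^ 2 ≤ D := by
        have hx : 0 < x := by
          rcases hx.eq_or_lt with rfl | hx
          · have : 0 < k * f₀ * f₁ := by positivity
            linarith
          · exact hx
        have : x * (k * f₁ ^ 2) ≤ x * D := by
          have := mul_le_mul_of_nonneg_left i1 (by positivity : 0 ≤ k * f₁)
          linarith
        exact le_of_mul_le_mul_left this hx
      have i3 : 0 ≤ f₀ * D - k * x * f₁ ^ 3 := by
        have := mul_le_mul_of_nonneg_left i2 hf₀.le
        have := mul_le_mul_of_nonneg_left i1 (by positivity : 0 ≤ k * f₁ ^ 2)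
        linarith
      have e : f₀ * lambda₃ c d = g₀ * (f₀ * D - k * x * f₁ ^ 3)
          + k * f₁ * (D * (f₀ - x * f₁) + f₀ * (D - k * f₁ ^ 2)) := by
        rw [h₃]; linear_combination (-x * k * f₁ ^ 2) * hD
      have j1 : 0 ≤ f₀ - x * f₁ := by linarith
      have j2 : 0 ≤ D - k * f₁ ^ 2 := by linarith
      have j3 : 0 ≤ f₀ * lambda₃ c d := by rw [e]; positivity
      exact nonneg_of_mul_nonneg_right j3 hf₀

/-- Representations in lowest terms of impedances of networks with two reactive elements are
regular. -/
theorem regular_of_realizable {c d : Fin 3 → ℝ} (hc : ∀ i, 0 ≤ c i) (hd : ∀ i, 0 ≤ d i)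
    (hR : sylvesterDet c d ≠ 0)
    (h : Realizable 2 fun s => (quadPoly c).eval s / (quadPoly d).eval s) : Regular c d := by
  have transfer : ∀ {c d : Fin 3 → ℝ}, (∀ i, 0 ≤ c i) → (∀ i, 0 ≤ d i) → sylvesterDet c d ≠ 0 →
      Extractable 1 (fun s => (quadPoly c).eval s / (quadPoly d).eval s) → Regular c d := by
    rintro c d hc hd hR ⟨r, k, x, G, hr, hk, hx, hG, hv⟩
    obtain ⟨hc0, hd0⟩ := ne_zero_of_sylvesterDet_ne_zero hR
    obtain ⟨f₁, f₀, g₁, g₀, hf₁, hf₀, hg₁, hg₀, hf, hg, e⟩ := hG.exists_bilinear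
    set d' : Fin 3 → ℝ := ![k * f₀ + x * g₀, k * f₁ + g₀ + x * g₁, g₁] with hd'
    set c' : Fin 3 → ℝ := ![x * f₀, f₀ + x * f₁, f₁] + r • d' with hc'
    have hreg : Regular c' d' := regular_of_bilinear_branch hr hk hx hf₀ hf₁ hg₀ hg₁ hd' hc'
    have hpoly : quadPoly c * quadPoly d' = quadPoly c' * quadPoly d := by
      refine polynomial_eq_of_pos fun s hs => ?_
      have hGs := hG.pos hs
      have hden : 0 < (quadPoly d).eval s := eval_quadPoly_pos hd hd0 hs
      have hfs : 0 < f₁ * s + f₀ := by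
        rw [e s hs] at hGs
        by_contra hn
        have z : f₁ * s + f₀ = 0 := le_antisymm (not_lt.1 hn) (by positivity)
        rw [z, zero_div] at hGs
        exact lt_irrefl _ hGs
      have e1 := hv s hs
      rw [e s hs, inv_div, div_add_div _ _ (by positivity) hfs.ne', inv_div] at e1
      have hd's : (quadPoly d').eval s = k * (f₁ * s + f₀) + (s + x) * (g₁ * s + g₀) := by
        rw [eval_quadPoly]; simp [hd']; ring
      have hd'p : 0 < (quadPoly d').eval s := by
        rw [hd's]; positivity
      have hc's : (quadPoly c').eval s = (s + x) * (f₁ * s + f₀) + r * (quadPoly d').eval s := by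
        simp only [eval_quadPoly, hc', Pi.add_apply, Pi.smul_apply, smul_eq_mul]
        simp; ring
      rw [← hd's, div_eq_iff hden.ne'] at e1
      rw [eval_mul, eval_mul, e1, hc's]
      field_simp
      ring
    -- Since `c/d` is in lowest terms, the pair read off from the network is a multiple of it, and
    -- the multiple must be positive for regularity to transfer.
    obtain ⟨μ, hμc, hμd⟩ := exists_smul_of_mul_eq hR hpoly
    have hμ : 0 < μ := by
      have hp : 0 < (quadPoly d').eval 1 := by
        rw [eval_quadPoly]; simp [hd']
        have : 0 ≤ x * g₀ := by positivity
        have : 0 ≤ x * g₁ := by positivity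
        have : 0 < k * (f₁ + f₀) := by positivity
        linarith
      rw [hμd, quadPoly_smul, eval_mul, eval_C] at hp
      exact pos_of_mul_pos_left hp (eval_quadPoly_pos hd hd0 one_pos).le
    rw [hμc, hμd] at hreg
    exact (Regular.smul_iff hμ).1 hreg
  obtain ⟨hc0, hd0⟩ := ne_zero_of_sylvesterDet_ne_zero hR
  obtain ⟨N, hN, hv⟩ := h
  have rev : ∀ s : ℝ, 0 < s → (quadPoly (reverseCoeffs c)).eval s / (quadPoly (reverseCoeffs d)).eval s
      = (quadPoly c).eval s⁻¹ / (quadPoly d).eval s⁻¹ := by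
    intro s hs
    rw [eval_reverseCoeffs _ hs.ne', eval_reverseCoeffs _ hs.ne',
      mul_div_mul_left _ _ (by positivity)]
  have hR' := hR
  rw [← sylvesterDet_reverseCoeffs] at hR'
  rcases N.realizable_or_extractable le_rfl one_le_two hN with h | h
  -- With one reactive element the function is bilinear, so both leading coefficients `c₂, d₂`
  -- vanish and `R₀ = 0`.
  · exfalso
    obtain ⟨f₁, f₀, g₁, g₀, hf₁, hf₀, hg₁, hg₀, hf, hg, e⟩ := h.exists_bilinear
    apply hR
    have hpoly : quadPoly c * quadPoly ![g₀, g₁, 0] = quadPoly ![f₀, f₁, 0] * quadPoly d := by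
      refine polynomial_eq_of_pos fun s hs => ?_
      have hden : 0 < (quadPoly d).eval s := eval_quadPoly_pos hd hd0 hs
      have e1 := e s hs
      have hgs : g₁ * s + g₀ ≠ 0 := by
        intro z
        rw [z, div_zero] at e1
        exact (N.val_pos hs).ne' e1
      rw [hv s hs, div_eq_div_iff hden.ne' hgs] at e1
      simpa [eval_quadPoly ![g₀, g₁, 0], eval_quadPoly ![f₀, f₁, 0]] using e1
    obtain ⟨μ, hμc, hμd⟩ := exists_smul_of_mul_eq hR hpoly
    have hμ : μ ≠ 0 := by
      rintro rfl
      have h1 := congrFun hμc 1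
      have h0 := congrFun hμc 0
      simp at h1 h0
      linarith
    have h2c := congrFun hμc 2
    have h2d := congrFun hμd 2
    simp [hμ] at h2c h2d
    rw [sylvesterDet_eq]; simp [alpha₂, alpha₃, h2c, h2d]
  · replace h := h.congr hv
    rcases h with h | h | h | h
    · exact transfer hc hd hR h
    · exact (transfer hd hc (by rwa [sylvesterDet_swap]) (h.congr fun s _ => inv_div _ _)).swap
    · have := (transfer (reverseCoeffs_nonneg hc) (reverseCoeffs_nonneg hd) hR'
        (h.congr fun s hs => (rev s hs).symm)).reverse
      rwa [reverseCoeffs_reverseCoeffs, reverseCoeffs_reverseCoeffs] at this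
    · have := (transfer (reverseCoeffs_nonneg hd) (reverseCoeffs_nonneg hc)
        (by rwa [sylvesterDet_swap])
        (h.congr fun s hs => by beta_reduce; rw [← rev s hs, inv_div])).swap.reverse
      rwa [reverseCoeffs_reverseCoeffs, reverseCoeffs_reverseCoeffs] at this

/-! ### Realization of the five boundary cases -/

/-- A ratio of triples from which a single-reactance branch and a regular pair are extracted. -/
theorem realizable_three_of_extraction {a b c d : Fin 3 → ℝ} {A B z ε : ℝ} {w : ℝ → ℝ}
    (hb : ∀ i, 0 ≤ b i) (hb0 : b ≠ 0) (hε : ε = 1 ∨ ε = -1)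
    (hA : 0 ≤ ε * A) (hB : 0 ≤ ε * B) (hB0 : B ≠ 0) (hz : 0 ≤ ε * z) (hz0 : z ≠ 0)
    (hc : ∀ i, 0 ≤ ε * c i) (hc0 : c ≠ 0) (hd : ∀ i, 0 ≤ ε * d i) (hd0 : d ≠ 0)
    (hreg : Regular (ε • c) (ε • d)) (hca : c = B • a - A • b)
    (hw : ∀ κ, 0 < κ → Realizable 1 fun s => (κ * w s)⁻¹)
    (hdw : ∀ s, 0 < s →
      (quadPoly d).eval s = B * ((quadPoly b).eval s - z * w s * (quadPoly c).eval s)) :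
    Realizable 3 fun s => (quadPoly a).eval s / (quadPoly b).eval s := by
  have hε0 : ε ≠ 0 := by rcases hε with rfl | rfl <;> norm_num
  have hε2 : ε * ε = 1 := by rcases hε with rfl | rfl <;> norm_num
  have hBz : 0 < B * z := by
    have h : B * z = (ε * B) * (ε * z) := by linear_combination (-B * z) * hε2
    have h' : 0 ≤ B * z := by rw [h]; positivity
    exact h'.lt_of_ne' (mul_ne_zero hB0 hz0)
  have hAB : 0 ≤ A / B := by
    have h : A / B = (ε * A) / (ε * B) := by field_simp
    rw [h]; positivity
  have hcd := hreg.realizable (fun i => by simpa using hc i) (fun i => by simpa using hd i)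
    (smul_ne_zero hε0 hc0) (smul_ne_zero hε0 hd0)
  -- The network is a resistance `A/B` in series with the parallel connection of a branch of
  -- admittance `Bzw` and the regular ratio `εc/εd`.
  refine (((hw _ hBz).par hcd).const_add hAB).congr fun s hs => ?_
  have hcs : (quadPoly c).eval s ≠ 0 := by
    have := eval_quadPoly_pos (p := ε • c) (fun i => by simpa using hc i)
      (smul_ne_zero hε0 hc0) hs
    rw [quadPoly_smul, eval_mul] at this
    exact right_ne_zero_of_mul this.ne'
  have hbs := eval_quadPoly_pos hb hb0 hs
  have hc' : (quadPoly c).eval s = B * (quadPoly a).eval s - A * (quadPoly b).eval s := by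
    rw [hca]; simp only [eval_quadPoly, Pi.sub_apply, Pi.smul_apply, smul_eq_mul]; ring
  have e : ((B * z * w s)⁻¹)⁻¹ +
      ((quadPoly (ε • c)).eval s / (quadPoly (ε • d)).eval s)⁻¹
      = B * (quadPoly b).eval s / (quadPoly c).eval s := by
    rw [inv_inv, inv_div, quadPoly_smul, quadPoly_smul, eval_mul, eval_mul, eval_C,
      mul_div_mul_left _ _ hε0, hdw s hs]
    field_simp
    ring
  rw [e, inv_div, hc']
  field_simp
  ring

theorem SameSign.exists_sign {l : List ℝ} (h : SameSign l) :
    ∃ ε : ℝ, (ε = 1 ∨ ε = -1) ∧ ∀ t ∈ l, 0 ≤ ε * t := by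
  rcases h with h | h
  · exact ⟨1, Or.inl rfl, fun t ht => by simpa using h t ht⟩
  · exact ⟨-1, Or.inr rfl, fun t ht => by simpa using h t ht⟩

/-- If `ã`, `c` have the same sign, then `c = b̃ a - ã b` can be nonzero only if `b̃ ≠ 0`. -/
theorem tilde_ne_zero {a b c : Fin 3 → ℝ} {A B ε : ℝ} (hb : ∀ i, 0 ≤ b i)
    (hε : ε = 1 ∨ ε = -1) (hA : 0 ≤ ε * A) (hc : ∀ i, 0 ≤ ε * c i) (hc0 : c ≠ 0)
    (hca : c = B • a - A • b) : B ≠ 0 := by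
  rintro rfl
  have hε0 : ε ≠ 0 := by rcases hε with rfl | rfl <;> norm_num
  apply hc0
  ext i
  have h1 := hc i
  have h2 : ε * c i = -(ε * A * b i) := by
    rw [hca]; simp [mul_assoc]
  have h3 := mul_nonneg hA (hb i)
  have h4 : ε * c i = 0 := by linarith
  exact (mul_eq_zero.1 h4).resolve_left hε0

/-- For `ε = ±1` quadratic forms are unchanged and cubic ones change by `ε`; this is why the `λᵢ`,
but not `α₂`, enter the same-sign list. -/
theorem regular_sign {c d : Fin 3 → ℝ} {ε : ℝ} (hε : ε = 1 ∨ ε = -1)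
    (h : (0 ≤ alpha₂ c d ∧ (0 ≤ ε * lambda₁ c d ∨ 0 ≤ ε * lambda₂ c d)) ∨
      (alpha₂ c d ≤ 0 ∧ (0 ≤ ε * lambda₃ c d ∨ 0 ≤ ε * lambda₄ c d))) :
    Regular (ε • c) (ε • d) := by
  have e2 : ε ^ 2 = 1 := by rcases hε with rfl | rfl <;> norm_num
  have e3 : ε ^ 3 = ε := by rcases hε with rfl | rfl <;> norm_num
  simpa only [Regular, alpha₂_smul, lambda₁_smul, lambda₂_smul, lambda₃_smul, lambda₄_smul, e2,
    e3, one_mul] using h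

/-- The removed branch has admittance proportional to `1/(s+x)`. The condition `R₀ ≠ 0` keeps `c`
from vanishing, hence `b̃` as well, and `h̃ ≠ 0` keeps `d` from vanishing. -/
theorem RL.Common.realizable {a b : Fin 3 → ℝ} {x z l : ℝ} (hx : 0 ≤ x) (hz : z ≠ 0)
    (h : RL.Common a b x z l)
    (hreg : ∀ ε : ℝ, (ε = 1 ∨ ε = -1) → 0 ≤ ε * l →
      Regular (ε • RL.c a b x) (ε • RL.d a b x z)) :
    Realizable 3 fun s => (quadPoly a).eval s / (quadPoly b).eval s := by
  obtain ⟨-, hb, hs, -, hh, hR⟩ := h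
  obtain ⟨ε, hε, hs⟩ := hs.exists_sign
  simp only [List.mem_cons, List.not_mem_nil, or_false, forall_eq_or_imp, forall_eq] at hs
  obtain ⟨hA, hB, hz', hd0, hd1, hd2, hf0, hf1, hl⟩ := hs
  have hc : ∀ i, 0 ≤ ε * RL.c a b x i := by
    intro i
    have e0 : 0 ≤ x * (ε * RL.f a b x 0) := by positivity
    have e1 : 0 ≤ x * (ε * RL.f a b x 1) := by positivity
    fin_cases i
    · simp [RL.c]; linarith
    · simp [RL.c]; linarith
    · simpa [RL.c] using hf1
  have hd : ∀ i, 0 ≤ ε * RL.d a b x z i := by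
    intro i; fin_cases i <;> assumption
  have hc0 : RL.c a b x ≠ 0 := by
    intro h0
    have f1 : RL.f a b x 1 = 0 := by simpa [RL.c] using congrFun h0 2
    have f0 : RL.f a b x 0 = 0 := by simpa [RL.c, f1] using congrFun h0 1
    apply hR
    simp [RL.f, bezoutian, vecMul, dotProduct, Fin.sum_univ_two] at f0 f1
    rw [sylvesterDet_eq]; simp only [alpha₁, alpha₂, alpha₃]
    -- If `[1 -x]` annihilates the Bezoutian, its determinant `R₀` is zero; the multipliers are the
    -- entries of its second row.
    linear_combination (a 2 * b 1 - b 2 * a 1) * f0 - (a 2 * b 0 - b 2 * a 0) * f1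
  have hB0 := tilde_ne_zero hb hε hA hc hc0 (c_eq a b x).1
  have hdn : RL.d a b x z ≠ 0 := by
    intro h0
    have h0' : RL.h a b x z = 0 := (smul_eq_zero.1 h0).resolve_left hB0
    apply hh
    rw [h0']; simp [RL.tilde, quadPoly]
  refine realizable_three_of_extraction hb (ne_zero_of_sylvesterDet_ne_zero hR).2 hε hA hB hB0 hz'
    hz hc hc0 hd hdn (hreg ε hε hl) (c_eq a b x).1 (w := fun s => (s + x)⁻¹) ?_ ?_
  · intro κ hκ
    refine (Realizable.bilinear (a := 1) (b := x) (c := 0) (d := κ) zero_le_one hx le_rfl hκ.le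
      (by linarith) (by linarith)).congr fun s hs => ?_
    have : s + x ≠ 0 := by positivity
    field_simp
    ring
  · intro s hs
    have : s + x ≠ 0 := by positivity
    have ec : (quadPoly (RL.c a b x)).eval s = (s + x) * (RL.f a b x 1 * s + RL.f a b x 0) := by
      rw [eval_quadPoly]; simp [RL.c]; ring
    rw [ec, RL.d, quadPoly_smul, eval_mul, eval_C]
    simp only [eval_quadPoly, RL.h]
    field_simp
    simp
    ring

/-- The inductor argument is repeated with the admittance `s/(xs+1)` of a resistor-capacitor branch.
-/
theorem RC.Cond₅.realizable {a b : Fin 3 → ℝ} {x z : ℝ} (hx : 0 ≤ x) (hz : z ≠ 0)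
    (h : RC.Cond₅ a b x z) :
    Realizable 3 fun s => (quadPoly a).eval s / (quadPoly b).eval s := by
  obtain ⟨-, hb, hs, hα, -, hh, hR⟩ := h
  obtain ⟨ε, hε, hs⟩ := hs.exists_sign
  simp only [List.mem_cons, List.not_mem_nil, or_false, forall_eq_or_imp, forall_eq] at hs
  obtain ⟨hA, hB, hz', hd0, hd1, hd2, hf0, hf1, hl⟩ := hs
  have hc : ∀ i, 0 ≤ ε * RC.c a b x i := by
    intro i
    have e0 : 0 ≤ x * (ε * RC.f a b x 0) := by positivity
    have e1 : 0 ≤ x * (ε * RC.f a b x 1) := by positivity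
    fin_cases i
    · simpa [RC.c] using hf0
    · simp [RC.c]; linarith
    · simp [RC.c]; linarith
  have hd : ∀ i, 0 ≤ ε * RC.d a b x z i := by
    intro i; fin_cases i <;> assumption
  have hc0 : RC.c a b x ≠ 0 := by
    intro h0
    have f0 : RC.f a b x 0 = 0 := by simpa [RC.c] using congrFun h0 0
    have f1 : RC.f a b x 1 = 0 := by simpa [RC.c, f0] using congrFun h0 1
    apply hR
    simp [RC.f, bezoutian] at f0 f1
    rw [sylvesterDet_eq]; simp only [alpha₁, alpha₂, alpha₃]
    linear_combination (a 2 * b 0 - b 2 * a 0) * f0 - (a 1 * b 0 - b 1 * a 0) * f1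
  have hB0 := tilde_ne_zero hb hε hA hc hc0 (c_eq a b x).2
  have hdn : RC.d a b x z ≠ 0 := by
    intro h0
    have h0' : RC.h a b x z = 0 := (smul_eq_zero.1 h0).resolve_left hB0
    apply hh
    rw [h0']; simp [RC.tilde]
  refine realizable_three_of_extraction hb (ne_zero_of_sylvesterDet_ne_zero hR).2 hε hA hB hB0 hz'
    hz hc hc0 hd hdn (regular_sign hε (Or.inl ⟨hα, Or.inl hl⟩)) (c_eq a b x).2
    (w := fun s => s / (x * s + 1)) ?_ ?_
  · intro κ hκ
    refine (Realizable.bilinear (a := x) (b := 1) (c := κ) (d := 0) hx zero_le_one hκ.le le_rfl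
      (by linarith) (by linarith)).congr fun s hs => ?_
    have : x * s + 1 ≠ 0 := by positivity
    field_simp
    ring
  · intro s hs
    have : x * s + 1 ≠ 0 := by positivity
    have ec : (quadPoly (RC.c a b x)).eval s
        = (x * s + 1) * (RC.f a b x 1 * s + RC.f a b x 0) := by
      rw [eval_quadPoly]; simp [RC.c]; ring
    rw [ec, RC.d, quadPoly_smul, eval_mul, eval_C]
    simp only [eval_quadPoly, RC.h]
    field_simp
    simp
    ring

theorem BoundaryCondition.nonneg {a b : Fin 3 → ℝ} {x z : ℝ} (h : BoundaryCondition a b x z) :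
    (∀ i, 0 ≤ a i) ∧ (∀ i, 0 ≤ b i) ∧ a ≠ 0 ∧ b ≠ 0 := by
  rcases h with ⟨⟨⟨ha, hb, -, -, -, hR⟩, -⟩, -⟩ | ⟨⟨⟨ha, hb, -, -, -, hR⟩, -⟩, -⟩ |
    ⟨⟨⟨ha, hb, -, -, -, hR⟩, -⟩, -⟩ | ⟨⟨⟨ha, hb, -, -, -, hR⟩, -⟩, -⟩ |
    ⟨⟨ha, hb, -, -, -, -, hR⟩, -⟩
  all_goals exact ⟨ha, hb, ne_zero_of_sylvesterDet_ne_zero hR⟩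

theorem BoundaryCondition.realizable {a b : Fin 3 → ℝ} {x z : ℝ} (hx : 0 ≤ x) (hz : z ≠ 0)
    (h : BoundaryCondition a b x z) :
    Realizable 3 fun s => (quadPoly a).eval s / (quadPoly b).eval s := by
  rcases h with ⟨⟨h, hα⟩, -⟩ | ⟨⟨h, hα⟩, -⟩ | ⟨⟨h, hα⟩, -⟩ | ⟨⟨h, hα⟩, -⟩ | ⟨h, -⟩
  · exact h.realizable hx hz fun ε hε hl => regular_sign hε (Or.inl ⟨hα, Or.inl hl⟩)
  · exact h.realizable hx hz fun ε hε hl => regular_sign hε (Or.inr ⟨hα, Or.inl hl⟩)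
  · exact h.realizable hx hz fun ε hε hl => regular_sign hε (Or.inr ⟨hα, Or.inr hl⟩)
  · exact h.realizable hx hz fun ε hε hl => regular_sign hε (Or.inl ⟨hα, Or.inr hl⟩)
  · exact h.realizable hx hz

/-! ### Return from values on the half-line to rational functions -/

/-- A network whose values are those of a ratio of triples has that ratio as its impedance. -/
theorem SPNetwork.impedance_eq_quadRatio (N : SPNetwork) {p q : Fin 3 → ℝ} (hq : ∀ i, 0 ≤ q i)
    (hq0 : q ≠ 0)
    (h : ∀ s, 0 < s → N.val s = (quadPoly p).eval s / (quadPoly q).eval s) :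
    N.impedance = quadRatio p q :=
  (N.impedance_eq_iff _ _ (mt quadPoly_eq_zero.1 hq0)).2 fun s hs => by
    rw [h s hs, div_mul_cancel₀ _ (eval_quadPoly_pos hq hq0 hs).ne']

theorem Realizable.quadRatio_mem {M : ℕ} {p q : Fin 3 → ℝ} (hq : ∀ i, 0 ≤ q i) (hq0 : q ≠ 0)
    (h : Realizable M fun s => (quadPoly p).eval s / (quadPoly q).eval s) :
    quadRatio p q ∈ impedanceClass M := by
  obtain ⟨N, hN, hv⟩ := h
  exact (mem_impedanceClass_iff M _).2 ⟨N, hN, N.impedance_eq_quadRatio hq hq0 hv⟩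

theorem inv_mem_impedanceClass {M : ℕ} {Z : RatFunc ℝ} (h : Z ∈ impedanceClass M) :
    Z⁻¹ ∈ impedanceClass M := by
  obtain ⟨N, hN, rfl⟩ := (mem_impedanceClass_iff M Z).1 h
  exact (mem_impedanceClass_iff M _).2 ⟨N.dual, N.numReactive_dual ▸ hN, N.impedance_dual⟩

theorem eval_ratio_reverseCoeffs (p q : Fin 3 → ℝ) {s : ℝ} (hs : 0 < s) :
    (quadPoly (reverseCoeffs p)).eval s / (quadPoly (reverseCoeffs q)).eval s
      = (quadPoly p).eval s⁻¹ / (quadPoly q).eval s⁻¹ := by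
  rw [eval_reverseCoeffs _ hs.ne', eval_reverseCoeffs _ hs.ne',
    mul_div_mul_left _ _ (by positivity)]

theorem TakesForm.mem_impedanceClass {Z : RatFunc ℝ} {a b : Fin 3 → ℝ} {x z : ℝ} (hx : 0 ≤ x)
    (hz : z ≠ 0) (h : BoundaryCondition a b x z) (hZ : TakesForm Z a b) :
    Z ∈ impedanceClass 3 := by
  obtain ⟨ha, hb, ha0, hb0⟩ := h.nonneg
  have hr := h.realizable hx hz
  rcases hZ with rfl | rfl
  · exact hr.quadRatio_mem hb hb0
  · refine Realizable.quadRatio_mem (reverseCoeffs_nonneg ha) (reverseCoeffs_ne_zero ha0)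
      (hr.inv.comp_inv.congr fun s hs => ?_)
    rw [inv_div, eval_ratio_reverseCoeffs _ _ hs]

/-! ### Biquadratic functions -/

/-- Coprime polynomials of degree at most two, one of which has degree two, have nonzero
resultant. -/
theorem sylvesterDet_ne_zero_of_isCoprime {p q : Fin 3 → ℝ}
    (h : IsCoprime (quadPoly p) (quadPoly q)) (h2 : p 2 ≠ 0 ∨ q 2 ≠ 0) :
    sylvesterDet p q ≠ 0 := by
  intro h0
  have key : ∀ {p q : Fin 3 → ℝ}, IsCoprime (quadPoly p) (quadPoly q) → p 2 ≠ 0 →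
      p 2 • q = q 2 • p → False := by
    intro p q h h2 e
    have hq : quadPoly q = C (q 2 / p 2) * quadPoly p := by
      rw [← quadPoly_smul, div_eq_inv_mul, mul_smul, ← e, smul_smul, inv_mul_cancel₀ h2, one_smul]
    have hu : IsUnit (quadPoly p) := h.isUnit_of_dvd' dvd_rfl ⟨_, hq.trans (mul_comm _ _)⟩
    have := natDegree_eq_zero_of_isUnit hu
    rw [quadPoly_natDegree h2] at this
    omega
  rcases sylvesterDet_eq_zero_cases h0 with ⟨z, z'⟩ | ⟨h2, e⟩ | ⟨w, hw, hw'⟩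
  · tauto
  · rcases h2 with h2 | h2
    · exact key h h2 e
    · exact key h.symm h2 e.symm
  · obtain ⟨u, v, e⟩ := h
    have := congrArg (Polynomial.eval w) e
    simp [hw, hw'] at this

/-- `F` is a ratio of two triples without common factor. -/
def BiquadraticOn (F : ℝ → ℝ) : Prop :=
  ∃ p q : Fin 3 → ℝ, sylvesterDet p q ≠ 0 ∧
    ∀ s, 0 < s → F s * (quadPoly q).eval s = (quadPoly p).eval s

theorem SPNetwork.biquadraticOn (N : SPNetwork) (h : IsBiquadratic N.impedance) :
    BiquadraticOn N.val := by
  set Z := N.impedance with hZ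
  have hP : Z.num.natDegree ≤ 2 := (le_max_left _ _).trans h.le
  have hQ : Z.denom.natDegree ≤ 2 := (le_max_right _ _).trans h.le
  refine ⟨fun i => Z.num.coeff i, fun i => Z.denom.coeff i, ?_, ?_⟩
  · refine sylvesterDet_ne_zero_of_isCoprime ?_ ?_
    · rw [quadPoly_of_natDegree_le hP, quadPoly_of_natDegree_le hQ]
      exact RatFunc.isCoprime_num_denom Z
    · have h' : max Z.num.natDegree Z.denom.natDegree = 2 := h
      rcases max_choice Z.num.natDegree Z.denom.natDegree with e | e
      · left
        have e2 : Z.num.natDegree = 2 := e ▸ h'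
        have hne : Z.num ≠ 0 := by intro h0; simp [h0] at e2
        have := leadingCoeff_ne_zero.2 hne
        rwa [leadingCoeff, e2] at this
      · right
        have e2 : Z.denom.natDegree = 2 := e ▸ h'
        have := leadingCoeff_ne_zero.2 Z.denom_ne_zero
        rwa [leadingCoeff, e2] at this
  · rw [quadPoly_of_natDegree_le hP, quadPoly_of_natDegree_le hQ]
    exact (N.impedance_eq_iff _ _ Z.denom_ne_zero).1 (RatFunc.num_div_denom Z).symm

theorem BiquadraticOn.inv {F : ℝ → ℝ} (h : BiquadraticOn F) (hF : ∀ s, 0 < s → 0 < F s) :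
    BiquadraticOn fun s => (F s)⁻¹ := by
  obtain ⟨p, q, hR, e⟩ := h
  refine ⟨q, p, by rwa [sylvesterDet_swap], fun s hs => ?_⟩
  rw [← e s hs, inv_mul_cancel_left₀ (hF s hs).ne']

theorem BiquadraticOn.comp_inv {F : ℝ → ℝ} (h : BiquadraticOn F) :
    BiquadraticOn fun s => F s⁻¹ := by
  obtain ⟨p, q, hR, e⟩ := h
  refine ⟨reverseCoeffs p, reverseCoeffs q, by rwa [sylvesterDet_reverseCoeffs], fun s hs => ?_⟩
  rw [eval_reverseCoeffs _ hs.ne', eval_reverseCoeffs _ hs.ne', ← e _ (inv_pos.2 hs)]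
  ring

/-- Impedances of networks with at most two reactive elements are ratios of triples with
non-negative coefficients. -/
theorem Realizable.exists_triples {F : ℝ → ℝ} (h : Realizable 2 F) :
    ∃ c d : Fin 3 → ℝ, (∀ i, 0 ≤ c i) ∧ (∀ i, 0 ≤ d i) ∧ c ≠ 0 ∧ d ≠ 0 ∧
      ∀ s, 0 < s → F s = (quadPoly c).eval s / (quadPoly d).eval s := by
  obtain ⟨N, hN, hv⟩ := h
  obtain ⟨P, Q, hP, hQ, dP, dQ, nP, nQ, -, e⟩ := N.exists_polynomials
  have eP := quadPoly_of_natDegree_le (dP.trans hN)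
  have eQ := quadPoly_of_natDegree_le (dQ.trans hN)
  refine ⟨fun i => P.coeff i, fun i => Q.coeff i, fun i => hP i, fun i => hQ i, ?_, ?_,
    fun s hs => ?_⟩
  · rwa [← quadPoly_eq_zero.ne, eP]
  · rwa [← quadPoly_eq_zero.ne, eQ]
  · rw [eP, eQ, ← hv s hs, (e s hs).2.2]

/-- A cancellation in the parallel connection of a resistor-inductor branch with a biquadratic
can only occur at the pole of the branch. -/
theorem eval_eq_zero_of_biquadraticOn {c d : Fin 3 → ℝ} {r k x : ℝ} (hc : ∀ i, 0 ≤ c i)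
    (hd : ∀ i, 0 ≤ d i) (hR : sylvesterDet c d ≠ 0) (hk : 0 < k) (hx : 0 ≤ x)
    (h : BiquadraticOn fun s =>
      r + (k / (s + x) + ((quadPoly c).eval s / (quadPoly d).eval s)⁻¹)⁻¹) :
    (quadPoly c).eval (-x) = 0 := by
  by_contra hne
  obtain ⟨p, q, hpq, e⟩ := h
  obtain ⟨hc0, hd0⟩ := ne_zero_of_sylvesterDet_ne_zero hR
  set A : ℝ[X] := (X + C x) * quadPoly c with hA
  set B : ℝ[X] := C k * quadPoly c + (X + C x) * quadPoly d with hB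
  -- Subtracting the series resistance is a row operation and does not change the resultant.
  set p' := p - r • q with hp'
  have hpq' : sylvesterDet p' q ≠ 0 := by
    convert hpq using 1
    simp only [hp', sylvesterDet_eq, alpha₁, alpha₂, alpha₃, Pi.sub_apply, Pi.smul_apply,
      smul_eq_mul]
    ring
  have hAB : quadPoly p' * B = A * quadPoly q := by
    refine polynomial_eq_of_pos fun s hs => ?_
    have hcs := eval_quadPoly_pos hc hc0 hs
    have hds := eval_quadPoly_pos hd hd0 hs
    have ep : (quadPoly p').eval s = (quadPoly p).eval s - r * (quadPoly q).eval s := by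
      simp only [hp', eval_quadPoly, Pi.sub_apply, Pi.smul_apply, smul_eq_mul]; ring
    have es := e s hs
    beta_reduce at es
    rw [inv_div, div_add_div _ _ (by positivity) hcs.ne', inv_div] at es
    rw [eval_mul, eval_mul, ep, ← es, hA, hB]
    simp only [eval_add, eval_mul, eval_C, eval_X]
    have : k * (quadPoly c).eval s + (s + x) * (quadPoly d).eval s ≠ 0 := by positivity
    field_simp
    ring
  have hcop := isCoprime_of_sylvesterDet_ne_zero hR
  have hXc : IsCoprime (X + C x) (quadPoly c) := by
    refine ⟨-C ((quadPoly c).eval (-x))⁻¹ * (C (c 2) * X + C (c 1 - c 2 * x)),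
      C ((quadPoly c).eval (-x))⁻¹, ?_⟩
    refine polynomial_eq_of_pos fun s _ => ?_
    simp only [eval_add, eval_mul, eval_neg, eval_C, eval_X, eval_one]
    field_simp
    simp only [eval_quadPoly]
    ring
  -- If `c(-x) ≠ 0`, nothing cancels in `A/B`. Then `A` and `B`, of formal degree three, divide
  -- quadratics, so their cubic coefficients `c₂, d₂` vanish, contradicting `R₀(c,d) ≠ 0`.
  have hcopAB : IsCoprime A B := by
    refine IsCoprime.mul_left ?_ ?_
    · rw [hB, IsCoprime.add_mul_left_right_iff]
      exact (isCoprime_mul_unit_left_right (isUnit_C.2 hk.ne'.isUnit) _ _).2 hXc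
    · rw [hB, add_comm, mul_comm (C k), IsCoprime.add_mul_left_right_iff]
      exact hXc.symm.mul_right hcop
  have hAp : A ∣ quadPoly p' := hcopAB.dvd_of_dvd_mul_right ⟨_, hAB⟩
  have hBq : B ∣ quadPoly q := hcopAB.symm.dvd_of_dvd_mul_left ⟨_, hAB.symm.trans (mul_comm _ _)⟩
  obtain ⟨hp0, hq0⟩ := ne_zero_of_sylvesterDet_ne_zero hpq'
  have dA := natDegree_le_of_dvd hAp (mt quadPoly_eq_zero.1 hp0)
  have dB := natDegree_le_of_dvd hBq (mt quadPoly_eq_zero.1 hq0)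
  have dA' : A.natDegree < 3 := by have := quadPoly_natDegree_le p'; omega
  have dB' : B.natDegree < 3 := by have := quadPoly_natDegree_le q; omega
  have cA : A.coeff 3 = c 2 := by
    rw [hA, add_mul, coeff_add, coeff_X_mul, coeff_C_mul,
      coeff_eq_zero_of_natDegree_lt (n := 3) (by have := quadPoly_natDegree_le c; omega)]
    simpa using quadPoly_coeff c 2
  have cB : B.coeff 3 = d 2 := by
    rw [hB, add_mul, coeff_add, coeff_add, coeff_X_mul, coeff_C_mul, coeff_C_mul,
      coeff_eq_zero_of_natDegree_lt (n := 3) (by have := quadPoly_natDegree_le c; omega),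
      coeff_eq_zero_of_natDegree_lt (n := 3) (by have := quadPoly_natDegree_le d; omega)]
    simpa using quadPoly_coeff d 2
  rw [coeff_eq_zero_of_natDegree_lt dA'] at cA
  rw [coeff_eq_zero_of_natDegree_lt dB'] at cB
  apply hR
  rw [sylvesterDet_eq]; simp [alpha₂, alpha₃, ← cA, ← cB]

/-! ### The boundary of the regular pairs -/

/-- A regular pair with negative `R₀` none of whose regularity conditions is tight is regular for
an open reason. -/
theorem Regular.strict {c d : Fin 3 → ℝ} (hc : ∀ i, 0 ≤ c i) (hd : ∀ i, 0 ≤ d i)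
    (hR : sylvesterDet c d < 0) (h : Regular c d)
    (h₁ : ¬(0 ≤ alpha₂ c d ∧ lambda₁ c d = 0)) (h₂ : ¬(0 ≤ alpha₂ c d ∧ lambda₂ c d = 0))
    (h₃ : ¬(alpha₂ c d ≤ 0 ∧ lambda₃ c d = 0)) (h₄ : ¬(alpha₂ c d ≤ 0 ∧ lambda₄ c d = 0)) :
    (0 < alpha₂ c d ∧ 0 < lambda₁ c d) ∨ (0 < alpha₂ c d ∧ 0 < lambda₂ c d) ∨
    (alpha₂ c d < 0 ∧ 0 < lambda₃ c d) ∨ (alpha₂ c d < 0 ∧ 0 < lambda₄ c d) ∨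
    (0 < lambda₁ c d ∧ 0 < lambda₃ c d) ∨ (0 < lambda₂ c d ∧ 0 < lambda₄ c d) := by
  rw [sylvesterDet_eq] at hR
  have key : ∀ u v w : ℝ, 0 ≤ w → u * v < 0 → 0 < w * u → 0 < -(w * v) := by
    intro u v w hw huv hwu
    have hw' : 0 < w := by
      rcases hw.eq_or_lt with rfl | hw
      · simp at hwu
      · exact hw
    have hu : 0 < u := pos_of_mul_pos_right hwu hw
    have hv : v < 0 := by
      by_contra hn
      have := mul_nonneg hu.le (not_lt.1 hn)
      linarith
    have := mul_neg_of_pos_of_neg hw' hv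
    linarith
  rcases h with ⟨hα, hl | hl⟩ | ⟨hα, hl | hl⟩
  · have hl' : 0 < lambda₁ c d := hl.lt_of_ne' fun e => h₁ ⟨hα, e⟩
    -- At `α₂ = 0` one has `λ₁ = d₁α₁`, `λ₃ = -d₁α₃` and `R₀ = α₁α₃ < 0`, so `λ₁ > 0` forces `λ₃ >
    -- 0`: regularity persists whichever sign `α₂` takes nearby. The remaining cases use the same
    -- argument.
    rcases hα.eq_or_lt with h0 | hα
    · right; right; right; right; left
      refine ⟨hl', ?_⟩
      simp only [lambda₁, lambda₃, ← h0, mul_zero, sub_zero, zero_sub] at hl' hR ⊢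
      exact key _ _ _ (hd 1) (by linarith) hl'
    · exact Or.inl ⟨hα, hl'⟩
  · have hl' : 0 < lambda₂ c d := hl.lt_of_ne' fun e => h₂ ⟨hα, e⟩
    rcases hα.eq_or_lt with h0 | hα
    · right; right; right; right; right
      refine ⟨hl', ?_⟩
      simp only [lambda₂, lambda₄, ← h0, mul_zero, sub_zero, zero_sub] at hl' hR ⊢
      exact key _ _ _ (hc 1) (by linarith) hl'
    · exact Or.inr (Or.inl ⟨hα, hl'⟩)
  · have hl' : 0 < lambda₃ c d := hl.lt_of_ne' fun e => h₃ ⟨hα, e⟩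
    rcases hα.eq_or_lt with h0 | hα
    · right; right; right; right; left
      refine ⟨?_, hl'⟩
      simp only [lambda₁, lambda₃, h0, mul_zero, sub_zero, zero_sub] at hl' hR ⊢
      have := key (-alpha₃ c d) (-alpha₁ c d) _ (hd 1) (by linarith) (by linarith)
      linarith
    · exact Or.inr (Or.inr (Or.inl ⟨hα, hl'⟩))
  · have hl' : 0 < lambda₄ c d := hl.lt_of_ne' fun e => h₄ ⟨hα, e⟩
    rcases hα.eq_or_lt with h0 | hα
    · right; right; right; right; right
      refine ⟨?_, hl'⟩
      simp only [lambda₂, lambda₄, h0, mul_zero, sub_zero, zero_sub] at hl' hR ⊢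
      have := key (-alpha₁ c d) (-alpha₃ c d) _ (hc 1) (by linarith) (by linarith)
      linarith
    · exact Or.inr (Or.inr (Or.inr (Or.inl ⟨hα, hl'⟩)))

/-- The denominator remaining after a part `t / (s + x)` of the admittance has been removed. -/
def remainder (b : Fin 3 → ℝ) (f₀ f₁ t : ℝ) : Fin 3 → ℝ := ![b 0 - t * f₀, b 1 - t * f₁, b 2]

/-- The least amount of the branch whose removal leaves a regular pair is on the boundary of the
regularity conditions. -/
theorem exists_boundary {c b : Fin 3 → ℝ} {f₀ f₁ k : ℝ} (hk : 0 < k) (hc : ∀ i, 0 ≤ c i)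
    (hd : ∀ t, t ∈ Set.Icc 0 k → ∀ i, 0 ≤ remainder b f₀ f₁ t i)
    (hR : ∀ t, t ∈ Set.Icc 0 k → sylvesterDet c (remainder b f₀ f₁ t) < 0)
    (h0 : ¬Regular c b) (hreg : Regular c (remainder b f₀ f₁ k)) :
    ∃ t, 0 < t ∧ t ≤ k ∧
      ((0 ≤ alpha₂ c (remainder b f₀ f₁ t) ∧ lambda₁ c (remainder b f₀ f₁ t) = 0) ∨
       (0 ≤ alpha₂ c (remainder b f₀ f₁ t) ∧ lambda₂ c (remainder b f₀ f₁ t) = 0) ∨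
       (alpha₂ c (remainder b f₀ f₁ t) ≤ 0 ∧ lambda₃ c (remainder b f₀ f₁ t) = 0) ∨
       (alpha₂ c (remainder b f₀ f₁ t) ≤ 0 ∧ lambda₄ c (remainder b f₀ f₁ t) = 0)) := by
  set δ : ℝ → Fin 3 → ℝ := remainder b f₀ f₁ with hδ
  have k0 : Continuous fun t => δ t 0 := by simp only [hδ, remainder]; simp; fun_prop
  have k1 : Continuous fun t => δ t 1 := by simp only [hδ, remainder]; simp; fun_prop
  have k2 : Continuous fun t => δ t 2 := by simp only [hδ, remainder]; simp; fun_prop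
  have ka : Continuous fun t => alpha₂ c (δ t) := by simp only [alpha₂]; fun_prop
  have kl₁ : Continuous fun t => lambda₁ c (δ t) := by
    simp only [lambda₁, alpha₁, alpha₂]; fun_prop
  have kl₂ : Continuous fun t => lambda₂ c (δ t) := by
    simp only [lambda₂, alpha₃, alpha₂]; fun_prop
  have kl₃ : Continuous fun t => lambda₃ c (δ t) := by
    simp only [lambda₃, alpha₃, alpha₂]; fun_prop
  have kl₄ : Continuous fun t => lambda₄ c (δ t) := by
    simp only [lambda₄, alpha₁, alpha₂]; fun_prop
  have hclosed : IsClosed {t | Regular c (δ t)} := by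
    simp only [Regular]
    refine IsClosed.union (IsClosed.inter (isClosed_le continuous_const ka)
      (IsClosed.union (isClosed_le continuous_const kl₁) (isClosed_le continuous_const kl₂)))
      (IsClosed.inter (isClosed_le ka continuous_const)
      (IsClosed.union (isClosed_le continuous_const kl₃) (isClosed_le continuous_const kl₄)))
  have hcomp : IsCompact (Set.Icc 0 k ∩ {t | Regular c (δ t)}) := isCompact_Icc.inter_right hclosed
  -- Regularity is a closed condition, so a least regular `t` exists; were no equality to hold
  -- there, `Regular.strict` would make regularity open at `t`, and a smaller regular parameter
  -- would exist.
  obtain ⟨t, ⟨htk, htr⟩, hmin⟩ := hcomp.exists_isLeast ⟨k, ⟨hk.le, le_rfl⟩, hreg⟩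
  have ht0 : t ≠ 0 := by
    rintro rfl
    apply h0
    convert (show Regular c (δ 0) from htr) using 1
    ext i; fin_cases i <;> simp [hδ, remainder]
  have htpos : 0 < t := htk.1.lt_of_ne' ht0
  refine ⟨t, htpos, htk.2, ?_⟩
  by_contra hn
  simp only [not_or] at hn
  obtain ⟨n₁, n₂, n₃, n₄⟩ := hn
  have hev : ∀ᶠ u in nhds t, Regular c (δ u) := by
    have pos : ∀ {g : ℝ → ℝ}, Continuous g → 0 < g t → ∀ᶠ u in nhds t, 0 < g u :=
      fun hg h => hg.continuousAt.eventually (lt_mem_nhds h)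
    have neg : ∀ {g : ℝ → ℝ}, Continuous g → g t < 0 → ∀ᶠ u in nhds t, g u < 0 :=
      fun hg h => hg.continuousAt.eventually (gt_mem_nhds h)
    rcases Regular.strict hc (hd t htk) (hR t htk) htr n₁ n₂ n₃ n₄ with
      ⟨h, h'⟩ | ⟨h, h'⟩ | ⟨h, h'⟩ | ⟨h, h'⟩ | ⟨h, h'⟩ | ⟨h, h'⟩
    · filter_upwards [pos ka h, pos kl₁ h'] with u hu hu'
      exact Or.inl ⟨hu.le, Or.inl hu'.le⟩
    · filter_upwards [pos ka h, pos kl₂ h'] with u hu hu'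
      exact Or.inl ⟨hu.le, Or.inr hu'.le⟩
    · filter_upwards [neg ka h, pos kl₃ h'] with u hu hu'
      exact Or.inr ⟨hu.le, Or.inl hu'.le⟩
    · filter_upwards [neg ka h, pos kl₄ h'] with u hu hu'
      exact Or.inr ⟨hu.le, Or.inr hu'.le⟩
    · filter_upwards [pos kl₁ h, pos kl₃ h'] with u hu hu'
      rcases le_total 0 (alpha₂ c (δ u)) with h | h
      · exact Or.inl ⟨h, Or.inl hu.le⟩
      · exact Or.inr ⟨h, Or.inl hu'.le⟩
    · filter_upwards [pos kl₂ h, pos kl₄ h'] with u hu hu'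
      rcases le_total 0 (alpha₂ c (δ u)) with h | h
      · exact Or.inl ⟨h, Or.inr hu.le⟩
      · exact Or.inr ⟨h, Or.inr hu'.le⟩
  obtain ⟨ε, hε, hball⟩ := Metric.eventually_nhds_iff.1 hev
  have hm : 0 < min (ε / 2) t := lt_min (by linarith) htpos
  have hm1 := min_le_left (ε / 2) t
  have hm2 := min_le_right (ε / 2) t
  have hu : Regular c (δ (t - min (ε / 2) t)) := by
    apply hball
    rw [Real.dist_eq, sub_sub_cancel_left, abs_neg, abs_of_pos hm]
    linarith
  have := hmin ⟨⟨by linarith, by linarith [htk.2]⟩, hu⟩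
  linarith

/-! ### Necessity for an extractable biquadratic function -/

/-- An extractable biquadratic function is realizable with two reactive elements or satisfies a
boundary condition. -/
theorem Extractable.exists_boundaryCondition {G : ℝ → ℝ} (h : Extractable 2 G)
    (hG : BiquadraticOn G) : Realizable 2 G ∨
      ∃ x z : ℝ, 0 ≤ x ∧ z ≠ 0 ∧ ∃ a b : Fin 3 → ℝ, BoundaryCondition a b x z ∧
        ∀ s, 0 < s → G s = (quadPoly a).eval s / (quadPoly b).eval s := by
  obtain ⟨r, k, x, H, hr, hk, hx, hH, hv⟩ := h
  obtain ⟨c, d, hc, hd, hc0, hd0, hcd⟩ := hH.exists_triples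
  have branch : ∀ t, 0 < t → Realizable 1 fun s => (t / (s + x))⁻¹ := by
    intro t ht
    refine (Realizable.bilinear (a := 1) (b := x) (c := 0) (d := t) zero_le_one hx le_rfl ht.le
      (by linarith) (by linarith)).congr fun s _ => ?_
    rw [inv_div]; simp
  by_cases hR : sylvesterDet c d = 0
  · left
    refine (((branch k hk).par (realizable_one_of_sylvesterDet_eq_zero hc hd hc0 hd0 hR)).const_add
      hr).congr fun s hs => ?_
    rw [hv s hs, hcd s hs, inv_inv]
  have hcx : (quadPoly c).eval (-x) = 0 := by
    refine eval_eq_zero_of_biquadraticOn (r := r) hc hd hR hk hx ?_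
    obtain ⟨p, q, hpq, e⟩ := hG
    exact ⟨p, q, hpq, fun s hs => by rw [← e s hs, hv s hs, hcd s hs]⟩
  obtain ⟨f₀, f₁, hf₀, hf₁, rfl⟩ := exists_factor hc hx hcx
  set c : Fin 3 → ℝ := ![x * f₀, f₀ + x * f₁, f₁] with hc'
  have hcs : ∀ s, (quadPoly c).eval s = (s + x) * (f₁ * s + f₀) := by
    intro s; rw [eval_quadPoly]; simp [hc']; ring
  have hf : 0 < f₁ + f₀ := by
    by_contra hn
    apply hc0
    have e₁ : f₁ = 0 := by linarith
    have e₀ : f₀ = 0 := by linarith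
    ext i; fin_cases i <;> simp [hc', e₀, e₁]
  have hfs : ∀ s, 0 < s → 0 < f₁ * s + f₀ := by
    intro s hs
    rcases hf₁.eq_or_lt with rfl | h
    · linarith
    · positivity
  -- The common factor `s + x` cancels, leaving `G = r + c/b` with `b = d + kf`, and `a = c + rb`.
  obtain ⟨b, hb⟩ : ∃ b : Fin 3 → ℝ, b = ![d 0 + k * f₀, d 1 + k * f₁, d 2] := ⟨_, rfl⟩
  obtain ⟨a, ha⟩ : ∃ a : Fin 3 → ℝ, a = c + r • b := ⟨_, rfl⟩
  have a0 : a 0 = x * f₀ + r * b 0 := by rw [ha]; rfl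
  have a1 : a 1 = f₀ + x * f₁ + r * b 1 := by rw [ha]; rfl
  have a2 : a 2 = f₁ + r * b 2 := by rw [ha]; rfl
  have hdk : d = remainder b f₀ f₁ k := by
    ext i; fin_cases i <;> simp [remainder, hb]
  have hb0 : ∀ i, 0 ≤ b i := by
    have h0 := hd 0; have h1 := hd 1; have h2 := hd 2
    intro i; fin_cases i <;> simp [hb] <;> positivity
  have ha0 : ∀ i, 0 ≤ a i := fun i => by
    rw [ha]; exact add_nonneg (hc i) (mul_nonneg hr (hb0 i))
  have hbs : ∀ s, (quadPoly b).eval s = (quadPoly d).eval s + k * (f₁ * s + f₀) := by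
    intro s; rw [eval_quadPoly, eval_quadPoly]; simp [hb]; ring
  have hbpos : ∀ s, 0 < s → 0 < (quadPoly b).eval s := by
    intro s hs
    have := hfs s hs
    have := eval_quadPoly_pos hd hd0 hs
    rw [hbs]; positivity
  have has : ∀ s, (quadPoly a).eval s = (quadPoly c).eval s + r * (quadPoly b).eval s := by
    intro s
    simp only [ha, eval_quadPoly, Pi.add_apply, Pi.smul_apply, smul_eq_mul]; ring
  have hGc : ∀ s, 0 < s → G s = r + (quadPoly c).eval s / (quadPoly b).eval s := by
    intro s hs
    have hcp := eval_quadPoly_pos hc hc0 hs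
    rw [hv s hs, hcd s hs, hcs, inv_div, div_add_div _ _ (by positivity)
      (mul_pos (by positivity) (hfs s hs)).ne', inv_div, hbs]
    have := hfs s hs
    have hdp := eval_quadPoly_pos hd hd0 hs
    have e : k * ((s + x) * (f₁ * s + f₀)) + (s + x) * (quadPoly d).eval s
        = (s + x) * ((quadPoly d).eval s + k * (f₁ * s + f₀)) := by ring
    rw [e, mul_div_mul_left _ _ (by positivity : s + x ≠ 0)]
  have hGab : ∀ s, 0 < s → G s = (quadPoly a).eval s / (quadPoly b).eval s := by
    intro s hs
    have := hbpos s hs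
    rw [hGc s hs, has]
    field_simp
    ring
  have hbne : b ≠ 0 := by
    rintro rfl
    have := hbpos 1 one_pos
    simp [eval_quadPoly] at this
  have hRab : sylvesterDet a b ≠ 0 := by
    obtain ⟨p, q, hpq, e⟩ := hG
    have hpoly : quadPoly p * quadPoly b = quadPoly a * quadPoly q := by
      refine polynomial_eq_of_pos fun s hs => ?_
      have := hbpos s hs
      rw [eval_mul, eval_mul, ← e s hs, hGab s hs]
      field_simp
    obtain ⟨μ, hμa, hμb⟩ := exists_smul_of_mul_eq hpq hpoly
    rw [hμa, hμb, sylvesterDet_smul]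
    refine mul_ne_zero (pow_ne_zero _ ?_) hpq
    rintro rfl
    exact hbne (by rw [hμb, zero_smul])
  have hane := (ne_zero_of_sylvesterDet_ne_zero hRab).1
  rcases hRab.lt_or_gt with hneg | hpos
  swap
  · left
    exact ((Regular.of_sylvesterDet_pos ha0 hb0 hpos).realizable ha0 hb0 hane hbne).congr
      fun s hs => (hGab s hs).symm
  set B := (quadPoly b).eval (-x) with hB
  set φ := f₀ - x * f₁ with hφ
  -- `E` is the resultant of `f₁s + f₀` with `b`, unchanged when multiples of `f` are subtracted
  -- from `b`. With `B = b(-x)` and `φ = f(-x)`, multiplicativity makes `R₀(c, b - tf) = -(B -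
  -- tφ)E`, affine in `t` and equal to `R₀(a,b)` at `t = 0`.
  obtain ⟨E, hE⟩ : ∃ E, E = b 2 * f₀ ^ 2 - b 1 * f₀ * f₁ + b 0 * f₁ ^ 2 := ⟨_, rfl⟩
  have hδx : ∀ t, (quadPoly (remainder b f₀ f₁ t)).eval (-x) = B - t * φ := by
    intro t; rw [hB, hφ, eval_quadPoly, eval_quadPoly]; simp [remainder]; ring
  have hRab' : sylvesterDet a b = -(B * E) := by
    rw [hB, hE, eval_quadPoly, sylvesterDet_eq]
    simp [alpha₁, alpha₂, alpha₃, a0, a1, a2]; ring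
  have hRt : ∀ t, sylvesterDet c (remainder b f₀ f₁ t) = -((B - t * φ) * E) := by
    intro t
    rw [hB, hE, hφ, eval_quadPoly, sylvesterDet_eq]
    simp [alpha₁, alpha₂, alpha₃, remainder, hc']; ring
  have hδnn : ∀ t, t ∈ Set.Icc 0 k → ∀ i, 0 ≤ remainder b f₀ f₁ t i := by
    intro t ht i
    have h0 := hd 0; have h1 := hd 1; have h2 := hd 2
    have e0 : 0 ≤ (k - t) * f₀ := mul_nonneg (by linarith [ht.2]) hf₀
    have e1 : 0 ≤ (k - t) * f₁ := mul_nonneg (by linarith [ht.2]) hf₁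
    fin_cases i
    · simp [remainder, hb]; linarith
    · simp [remainder, hb]; linarith
    · simpa [remainder, hb] using h2
  have hBE : 0 < B * E := by linarith
  -- If the resultant is positive at `t = k`, then `B - tφ` vanishes at `t = B/φ` in between. There
  -- `b - tf` is divisible by `s + x`, so `c/(b - tf)` is bilinear and two reactive elements
  -- suffice.
  rcases (show sylvesterDet c d ≠ 0 from hR).lt_or_gt with hcdneg | hcdpos
  swap
  · left
    rw [hdk, hRt] at hcdpos
    have hφE : 0 < φ * E := by
      have : 0 < k * (φ * E) := by linarith
      exact pos_of_mul_pos_right this hk.le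
    have hφ0 : φ ≠ 0 := left_ne_zero_of_mul hφE.ne'
    have hE0 : E ≠ 0 := right_ne_zero_of_mul hφE.ne'
    obtain ⟨t, ht⟩ : ∃ t, t = B / φ := ⟨_, rfl⟩
    have ht' : t = (B * E) / (φ * E) := by rw [ht, mul_div_mul_right _ _ hE0]
    have htpos : 0 < t := by rw [ht']; positivity
    have htk : t ≤ k := by rw [ht', div_le_iff₀ hφE]; linarith
    have hzero : (quadPoly (remainder b f₀ f₁ t)).eval (-x) = 0 := by
      rw [hδx, ht]; field_simp; ring
    obtain ⟨g₀, g₁, hg₀, hg₁, hg⟩ := exists_factor (hδnn t ⟨htpos.le, htk⟩) hx hzero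
    have hbt : ∀ s, (quadPoly b).eval s = (s + x) * (g₁ * s + g₀) + t * (f₁ * s + f₀) := by
      intro s
      have e1 : (quadPoly (remainder b f₀ f₁ t)).eval s = (s + x) * (g₁ * s + g₀) := by
        rw [hg, eval_quadPoly]; simp; ring
      have e2 : (quadPoly (remainder b f₀ f₁ t)).eval s
          = (quadPoly b).eval s - t * (f₁ * s + f₀) := by
        rw [eval_quadPoly, eval_quadPoly]; simp [remainder]; ring
      linarith
    have hfin : Realizable 2 fun s => (t / (s + x) + (g₁ * s + g₀) / (f₁ * s + f₀))⁻¹ := by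
      rcases (show 0 ≤ g₁ + g₀ by positivity).eq_or_lt with hz | hp
      · have z₁ : g₁ = 0 := by linarith
        have z₀ : g₀ = 0 := by linarith
        refine ((branch t htpos).congr fun s hs => ?_).mono one_le_two
        simp [z₁, z₀]
      · refine ((branch t htpos).par (Realizable.bilinear hf₁ hf₀ hg₁ hg₀ hf hp)).congr
          fun s hs => ?_
        rw [inv_inv, inv_div]
    refine (hfin.const_add hr).congr fun s hs => ?_
    have h1 := hfs s hs
    have h2 := hbpos s hs
    have h3 : s + x ≠ 0 := by positivity
    rw [hGc s hs, div_add_div _ _ h3 h1.ne', inv_div, hcs, hbt]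
    congr 2
    ring
  by_cases h0 : Regular c b
  · left
    exact ((h0.realizable hc hb0 hc0 hbne).const_add hr).congr fun s hs => (hGc s hs).symm
  right
  -- An affine function positive at both ends of `[0, k]` is positive throughout.
  have hseg : ∀ t, t ∈ Set.Icc 0 k → 0 < (B - t * φ) * E := by
    intro t ht
    have e : k * ((B - t * φ) * E) = (k - t) * (B * E) + t * ((B - k * φ) * E) := by ring
    rw [hdk, hRt] at hcdneg
    have i1 : 0 < (B - k * φ) * E := by linarith
    have i2 : 0 < k * ((B - t * φ) * E) := by
      rw [e]
      rcases ht.1.eq_or_lt with h | h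
      · rw [← h]; simp only [sub_zero, zero_mul, add_zero]; positivity
      · have := mul_nonneg (sub_nonneg.2 ht.2) hBE.le
        have := mul_pos h i1
        linarith
    exact pos_of_mul_pos_right i2 hk.le
  have hregd : Regular c d := regular_of_realizable hc hd hR (hH.congr hcd)
  obtain ⟨t, ht0, htk, hbd⟩ := exists_boundary hk hc hδnn
    (fun t ht => by rw [hRt]; linarith [hseg t ht]) h0 (hdk ▸ hregd)
  have htmem : t ∈ Set.Icc 0 k := ⟨ht0.le, htk⟩
  have hB0 : B ≠ 0 := left_ne_zero_of_mul hBE.ne'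
  -- With `z = t/B` the derived quantities are `b̃ = B`, `ã = rB`, `h = b - tf`, and `B` times the
  -- present `f`, `c` and `b - tf`; hence all have the sign of `B`.
  have tb : RL.tilde b x = B := rfl
  have ta : RL.tilde a x = r * B := by
    rw [RL.tilde, has, hcx, zero_add]
  have tf0 : RL.f a b x 0 = B * f₀ := by
    rw [hB, eval_quadPoly]
    simp [RL.f, bezoutian, vecMul, dotProduct, Fin.sum_univ_two, a0, a1, a2]; ring
  have tf1 : RL.f a b x 1 = B * f₁ := by
    rw [hB, eval_quadPoly]
    simp [RL.f, bezoutian, vecMul, dotProduct, Fin.sum_univ_two, a0, a1, a2]; ring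
  have tc : RL.c a b x = B • c := by
    ext i; fin_cases i <;> simp [RL.c, tf0, tf1, hc'] <;> ring
  have th : RL.h a b x (t / B) = remainder b f₀ f₁ t := by
    ext i; fin_cases i <;> simp [RL.h, tf0, tf1, remainder] <;> field_simp
  have td : RL.d a b x (t / B) = B • remainder b f₀ f₁ t := by
    rw [RL.d, th, tb]
  set δ := remainder b f₀ f₁ t with hδ
  have hδ0 := hδnn t htmem
  have common : ∀ l, l = 0 → RL.Common a b x (t / B) l := by
    rintro l rfl
    refine ⟨ha0, hb0, ?_, ?_, ?_, hRab⟩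
    · rw [SameSign, ta, tb, td, tf0, tf1]
      have d0 := hδ0 0; have d1 := hδ0 1; have d2 := hδ0 2
      simp only [List.mem_cons, List.not_mem_nil, or_false, forall_eq_or_imp, forall_eq,
        Pi.smul_apply, smul_eq_mul]
      rcases hB0.lt_or_gt with hBn | hBp
      · right
        refine ⟨mul_nonpos_of_nonneg_of_nonpos hr hBn.le, hBn.le,
          div_nonpos_of_nonneg_of_nonpos ht0.le hBn.le, ?_, ?_, ?_, ?_, ?_, le_rfl⟩
        all_goals exact mul_nonpos_of_nonpos_of_nonneg hBn.le (by assumption)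
      · left
        refine ⟨?_, ?_, ?_, ?_, ?_, ?_, ?_, ?_, le_rfl⟩ <;> positivity
    · have hs := hseg t htmem
      rw [tb, th, RL.tilde, hδx, hRab']
      have : B * (B - t * φ) * -(B * E) = -(B ^ 2 * ((B - t * φ) * E)) := by ring
      rw [this]
      have : 0 ≤ B ^ 2 * ((B - t * φ) * E) := by positivity
      linarith
    · rw [th, RL.tilde, hδx]
      exact left_ne_zero_of_mul (hseg t htmem).ne'
  have hα : alpha₂ (RL.c a b x) (RL.d a b x (t / B)) = B ^ 2 * alpha₂ c δ := by
    rw [tc, td, alpha₂_smul]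
  have hαp : 0 ≤ alpha₂ c δ → 0 ≤ alpha₂ (RL.c a b x) (RL.d a b x (t / B)) := fun h => by
    rw [hα]; positivity
  have hαn : alpha₂ c δ ≤ 0 → alpha₂ (RL.c a b x) (RL.d a b x (t / B)) ≤ 0 := fun h => by
    rw [hα]; exact mul_nonpos_of_nonneg_of_nonpos (sq_nonneg B) h
  refine ⟨x, t / B, hx, div_ne_zero ht0.ne' hB0, a, b, ?_, hGab⟩
  rcases hbd with ⟨h, h'⟩ | ⟨h, h'⟩ | ⟨h, h'⟩ | ⟨h, h'⟩
  · have e : lambda₁ (RL.c a b x) (RL.d a b x (t / B)) = 0 := by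
      rw [tc, td, lambda₁_smul, h', mul_zero]
    exact Or.inl ⟨⟨common _ e, hαp h⟩, e⟩
  · have e : lambda₂ (RL.c a b x) (RL.d a b x (t / B)) = 0 := by
      rw [tc, td, lambda₂_smul, h', mul_zero]
    exact Or.inr (Or.inr (Or.inr (Or.inl ⟨⟨common _ e, hαp h⟩, Or.inl e⟩)))
  · have e : lambda₃ (RL.c a b x) (RL.d a b x (t / B)) = 0 := by
      rw [tc, td, lambda₃_smul, h', mul_zero]
    exact Or.inr (Or.inl ⟨⟨common _ e, hαn h⟩, e⟩)
  · have e : lambda₄ (RL.c a b x) (RL.d a b x (t / B)) = 0 := by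
      rw [tc, td, lambda₄_smul, h', mul_zero]
    exact Or.inr (Or.inr (Or.inl ⟨⟨common _ e, hαn h⟩, Or.inl e⟩))

end

/-! ### The main equivalence -/

theorem theorem34 (Z : RatFunc ℝ) (hZ : IsBiquadratic Z) :
    Z ∈ impedanceClass 3 ↔
      (Z ∈ impedanceClass 2 ∨
        ∃ x z : ℝ, 0 ≤ x ∧ z ≠ 0 ∧
          ∃ a b : Fin 3 → ℝ, (TakesForm Z a b ∨ TakesForm Z⁻¹ a b) ∧
            BoundaryCondition a b x z) := by
  constructor
  · intro h
    obtain ⟨N, hN, rfl⟩ := (mem_impedanceClass_iff 3 Z).1 h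
    have mem_two : Realizable 2 N.val → N.impedance ∈ impedanceClass 2 := by
      rintro ⟨N', hN', hv⟩
      refine (mem_impedanceClass_iff 2 _).2 ⟨N', hN', ?_⟩
      obtain ⟨P, Q, -, -, -, -, -, nQ, e, -⟩ := N.exists_polynomials
      rw [e]
      refine (N'.impedance_eq_iff P Q nQ).2 fun s hs => ?_
      rw [hv s hs]
      exact (N.impedance_eq_iff P Q nQ).1 e s hs
    have hbi := N.biquadraticOn hZ
    have hpos : ∀ s, 0 < s → 0 < N.val s := fun s hs => N.val_pos hs
    -- The variants `F`, `1/F`, `F(1/s)`, `1/F(1/s)` lead respectively to the first form for `Z`,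
    -- the first for `1/Z`, the second for `1/Z` and the second for `Z`.
    rcases N.realizable_or_extractable one_le_two le_rfl hN with h | h | h | h | h
    · exact Or.inl (mem_two h)
    · rcases h.exists_boundaryCondition hbi with h | ⟨x, z, hx, hz, a, b, hbc, e⟩
      · exact Or.inl (mem_two h)
      · obtain ⟨-, hb, -, hb0⟩ := hbc.nonneg
        exact Or.inr ⟨x, z, hx, hz, a, b, Or.inl (Or.inl (N.impedance_eq_quadRatio hb hb0 e)), hbc⟩
    · rcases h.exists_boundaryCondition (hbi.inv hpos) with h | ⟨x, z, hx, hz, a, b, hbc, e⟩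
      · exact Or.inl (mem_two (h.inv.congr fun s _ => inv_inv _))
      · obtain ⟨-, hb, -, hb0⟩ := hbc.nonneg
        refine Or.inr ⟨x, z, hx, hz, a, b, Or.inr (Or.inl ?_), hbc⟩
        rw [← N.impedance_dual]
        exact N.dual.impedance_eq_quadRatio hb hb0 fun s hs => by rw [N.val_dual, e s hs]
    · rcases h.exists_boundaryCondition hbi.comp_inv with h | ⟨x, z, hx, hz, a, b, hbc, e⟩
      · exact Or.inl (mem_two (h.comp_inv.congr fun s _ => by rw [inv_inv]))
      · obtain ⟨ha, -, ha0, -⟩ := hbc.nonneg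
        refine Or.inr ⟨x, z, hx, hz, a, b, Or.inr (Or.inr ?_), hbc⟩
        rw [← N.impedance_dual]
        refine N.dual.impedance_eq_quadRatio (reverseCoeffs_nonneg ha) (reverseCoeffs_ne_zero ha0)
          fun s hs => ?_
        have es := e _ (inv_pos.2 hs)
        rw [inv_inv] at es
        rw [N.val_dual, eval_ratio_reverseCoeffs _ _ hs, es, inv_div]
    · rcases h.exists_boundaryCondition
        (hbi.comp_inv.inv fun s hs => hpos _ (inv_pos.2 hs)) with h | ⟨x, z, hx, hz, a, b, hbc, e⟩
      · exact Or.inl (mem_two (h.comp_inv.inv.congr fun s _ => by simp only [inv_inv]))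
      · obtain ⟨ha, -, ha0, -⟩ := hbc.nonneg
        refine Or.inr ⟨x, z, hx, hz, a, b, Or.inl (Or.inr ?_), hbc⟩
        refine N.impedance_eq_quadRatio (reverseCoeffs_nonneg ha) (reverseCoeffs_ne_zero ha0)
          fun s hs => ?_
        have es := e _ (inv_pos.2 hs)
        rw [inv_inv] at es
        rw [eval_ratio_reverseCoeffs _ _ hs, ← inv_inv (N.val s), es, inv_div]
  · rintro (h | ⟨x, z, hx, hz, a, b, h | h, hbc⟩)
    · obtain ⟨N, hN, e⟩ := (mem_impedanceClass_iff 2 Z).1 h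
      exact (mem_impedanceClass_iff 3 Z).2 ⟨N, hN.trans (by norm_num), e⟩
    · exact h.mem_impedanceClass hx hz hbc
    · have := inv_mem_impedanceClass (h.mem_impedanceClass hx hz hbc)
      rwa [inv_inv] at this
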